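/- Let $p,n\in\mathbb N$, let $j=\mathrm{diag}(I_p,-I_p)$, let $c\in\mathbb R$, $c\neq 0$, and let $\alpha$ be a $p\times p$ complex matrix with $\alpha\alpha^*=I_p$. Put $$\beta(x)=\begin{bmatrix} e^{icx}I_p & e^{-icx}\alpha\end{bmatrix},\qquad H(x)=\beta(x)^*\beta(x)\qquad(x\ge 0).$$ Let $\mathcal A$ and $\mathcal S(0)$ be $n\times n$ complex matrices and $\Lambda(0)$ an $n\times 2p$ complex matrix with $$\det\mathcal A\neq 0,\qquad \mathcal S(0)>0,\qquad \mathcal A\,\mathcal S(0)-\mathcal S(0)\mathcal A^*=i\,\Lambda(0)\,j\,\Lambda(0)^*,$$ and let $\Lambda(x)$, $\mathcal S(x)$ $(x\ge 0)$ be the solutions, with these initial values, of $$\Lambda'(x)=-i\mathcal A\Lambda(x)jH(x),\qquad \mathcal S'(x)=\Lambda(x)jH(x)j\Lambda(x)^*.$$ Set $$w_{\mathcal A}(x,\lambda)=I_{2p}-ij\Lambda(x)^*\mathcal S(x)^{-1}(\mathcal A-\lambda I_n)^{-1}\Lambda(x),\qquad v(0,\lambda)=w_{\mathcal A}(0,0)^{-1}w_{\mathcal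 A}(0,\lambda),$$ $$\widetilde\beta(x)=\beta(x)w_{\mathcal A}(x,0),\qquad \widetilde H(x)=\widetilde\beta(x)^*\widetilde\beta(x).$$ For $\lambda\in\mathbb C_+=\{\Im\lambda>0\}$ let $z_1(\lambda)$ be the square root of $c(2\lambda+c)$ with $\Im z_1(\lambda)>0$, and let $$E_1(\lambda)=\begin{bmatrix}-\alpha\\ \frac1\lambda(\lambda+c-z_1(\lambda))I_p\end{bmatrix}.$$ A Weyl function of the canonical system $w'(x,\lambda)=i\lambda j\widetilde H(x)w(x,\lambda)$ on $[0,\infty)$ is a holomorphic $p\times p$ matrix function $\varphi$ on $\mathbb C_+$ such that, for every $\lambda\in\mathbb C_+$, $$\int_0^\infty\begin{bmatrix}I_p&\varphi(\lambda)^*\end{bmatrix}\widetilde W(x,\lambda)^*\widetilde H(x)\widetilde W(x,\lambda)\begin{bmatrix}I_p\\ \varphi(\lambda)\end{bmatrix}dx<\infty,$$ where $\widetilde W$ is the fundamental solution of the system normalized by $\widetilde W(0,\lambda)=I_{2p}$. Then this canonical system has a unique Weyl function $\varphi$ (Weyl's limit point case). Moreover, for every $\lambda\in\mathbb C_+$ which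 is not an eigenvalue of $\mathcal A$, the matrix $\begin{bmatrix}I_p&0\end{bmatrix}v(0,\lambda)E_1(\lambda)$ is invertible and $$\varphi(\lambda)=\begin{bmatrix}0&I_p\end{bmatrix}v(0,\lambda)E_1(\lambda)\Big(\begin{bmatrix}I_p&0\end{bmatrix}v(0,\lambda)E_1(\lambda)\Big)^{-1}.$$ -/

import Mathlib

open Matrix MeasureTheory Set
open scoped ComplexOrder

namespace CanonicalGBDT

noncomputable section

/-- The open upper half-plane. -/
def upperHalf : Set ℂ := {lam | 0 < lam.im}

/-- The signature matrix `j = diag(I_p, -I_p)`. -/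
def sig (p : ℕ) : Matrix (Fin p ⊕ Fin p) (Fin p ⊕ Fin p) ℂ :=
  Matrix.fromBlocks 1 0 0 (-1)

/-- `W` is the fundamental solution, normalized by `W 0 = I`, of the canonical system
`W' = i lam j H W` on `[0, ∞)` with (continuous) Hamiltonian `H`, at spectral parameter `lam`. -/
def IsFundamentalSolution {p : ℕ} (H : ℝ → Matrix (Fin p ⊕ Fin p) (Fin p ⊕ Fin p) ℂ) (lam : ℂ)
    (W : ℝ → Matrix (Fin p ⊕ Fin p) (Fin p ⊕ Fin p) ℂ) : Prop :=
  W 0 = 1 ∧ ∀ x : ℝ, 0 ≤ x → ∀ i k,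
    HasDerivWithinAt (fun t => W t i k)
      (((Complex.I * lam) • (sig p * H x * W x)) i k) (Ici 0) x

/-- The integrand `[I M*] W* H W [I; M]`, for the values of `H` and `W` at one point. -/
def weylDensity {p : ℕ} (H W : Matrix (Fin p ⊕ Fin p) (Fin p ⊕ Fin p) ℂ)
    (M : Matrix (Fin p) (Fin p) ℂ) : Matrix (Fin p) (Fin p) ℂ :=
  (Matrix.fromRows (1 : Matrix (Fin p) (Fin p) ℂ) M)ᴴ * Wᴴ * H * W *
    Matrix.fromRows (1 : Matrix (Fin p) (Fin p) ℂ) M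

/-- `φ` is a Weyl function of the canonical system with Hamiltonian `H` on `[0, ∞)`: it is
holomorphic in the upper half-plane and, for every `lam` there,
`∫₀^∞ [I φ*] W* H W [I; φ] dx < ∞`, with `W` the normalized fundamental solution. -/
def IsWeylFunction {p : ℕ} (H : ℝ → Matrix (Fin p ⊕ Fin p) (Fin p ⊕ Fin p) ℂ)
    (φ : ℂ → Matrix (Fin p) (Fin p) ℂ) : Prop :=
  (∀ i k, DifferentiableOn ℂ (fun lam => φ lam i k) upperHalf) ∧
  ∀ lam ∈ upperHalf, ∃ W : ℝ → Matrix (Fin p ⊕ Fin p) (Fin p ⊕ Fin p) ℂ,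
    IsFundamentalSolution H lam W ∧
    ∀ i k, IntegrableOn (fun x : ℝ => weylDensity (H x) (W x) (φ lam) i k) (Ici 0) volume

/-- The initial `β(x) = [e^{icx} I_p, e^{-icx} α]`. -/
def beta {p : ℕ} (c : ℝ) (α : Matrix (Fin p) (Fin p) ℂ) (x : ℝ) :
    Matrix (Fin p) (Fin p ⊕ Fin p) ℂ :=
  Matrix.fromCols (Complex.exp (Complex.I * c * x) • (1 : Matrix (Fin p) (Fin p) ℂ))
    (Complex.exp (-(Complex.I * c * x)) • α)

/-- The initial Hamiltonian `H(x) = β(x)* β(x)`. -/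
def initHam {p : ℕ} (c : ℝ) (α : Matrix (Fin p) (Fin p) ℂ) (x : ℝ) :
    Matrix (Fin p ⊕ Fin p) (Fin p ⊕ Fin p) ℂ :=
  (beta c α x)ᴴ * beta c α x

/-- `Λ` and `S` are the matrix functions on `[0, ∞)` generated from the initial Hamiltonian `H`
by the matrix `A` and the initial values `Λ₀`, `S₀`:
`Λ' = -i A Λ j H`, `S' = Λ j H j Λ*`, `Λ(0) = Λ₀`, `S(0) = S₀`. -/
structure IsGBDT {p n : ℕ} (H : ℝ → Matrix (Fin p ⊕ Fin p) (Fin p ⊕ Fin p) ℂ)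
    (A S₀ : Matrix (Fin n) (Fin n) ℂ) (Λ₀ : Matrix (Fin n) (Fin p ⊕ Fin p) ℂ)
    (Λ : ℝ → Matrix (Fin n) (Fin p ⊕ Fin p) ℂ) (S : ℝ → Matrix (Fin n) (Fin n) ℂ) : Prop where
  Λ_zero : Λ 0 = Λ₀
  S_zero : S 0 = S₀
  Λ_deriv : ∀ x : ℝ, 0 ≤ x → ∀ i k,
    HasDerivWithinAt (fun t => Λ t i k)
      ((-Complex.I • (A * Λ x * sig p * H x)) i k) (Ici 0) x
  S_deriv : ∀ x : ℝ, 0 ≤ x → ∀ i k,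
    HasDerivWithinAt (fun t => S t i k)
      ((Λ x * sig p * H x * sig p * (Λ x)ᴴ) i k) (Ici 0) x

/-- The transfer matrix function `w_A(lam) = I - i j Λ* S⁻¹ (A - lam I)⁻¹ Λ` of a triple
`A`, `S`, `Λ` of matrices. -/
def transfer {p n : ℕ} (A S : Matrix (Fin n) (Fin n) ℂ)
    (Λ : Matrix (Fin n) (Fin p ⊕ Fin p) ℂ) (lam : ℂ) :
    Matrix (Fin p ⊕ Fin p) (Fin p ⊕ Fin p) ℂ :=
  1 - Complex.I • (sig p * Λᴴ * S⁻¹ * (A - lam • 1)⁻¹ * Λ)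

/-- The Darboux matrix `v(lam) = w_A(0)⁻¹ w_A(lam)` of a triple `A`, `S`, `Λ` of matrices. -/
def darboux {p n : ℕ} (A S : Matrix (Fin n) (Fin n) ℂ)
    (Λ : Matrix (Fin n) (Fin p ⊕ Fin p) ℂ) (lam : ℂ) :
    Matrix (Fin p ⊕ Fin p) (Fin p ⊕ Fin p) ℂ :=
  (transfer A S Λ 0)⁻¹ * transfer A S Λ lam

/-- The transformed `β̃(x) = β(x) w_A(x, 0)`. -/
def betaT {p n : ℕ} (c : ℝ) (α : Matrix (Fin p) (Fin p) ℂ) (A : Matrix (Fin n) (Fin n) ℂ)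
    (Λ : ℝ → Matrix (Fin n) (Fin p ⊕ Fin p) ℂ) (S : ℝ → Matrix (Fin n) (Fin n) ℂ) (x : ℝ) :
    Matrix (Fin p) (Fin p ⊕ Fin p) ℂ :=
  beta c α x * transfer A (S x) (Λ x) 0

/-- The transformed Hamiltonian `H̃(x) = β̃(x)* β̃(x)`. -/
def transHam {p n : ℕ} (c : ℝ) (α : Matrix (Fin p) (Fin p) ℂ) (A : Matrix (Fin n) (Fin n) ℂ)
    (Λ : ℝ → Matrix (Fin n) (Fin p ⊕ Fin p) ℂ) (S : ℝ → Matrix (Fin n) (Fin n) ℂ) (x : ℝ) :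
    Matrix (Fin p ⊕ Fin p) (Fin p ⊕ Fin p) ℂ :=
  (betaT c α A Λ S x)ᴴ * betaT c α A Λ S x

/-- The square root `z₁(lam)` of `c (2 lam + c)` with positive imaginary part, written as
`i √(-c (2 lam + c))` with the principal branch. -/
def z1 (c : ℝ) (lam : ℂ) : ℂ :=
  Complex.I * (-((c : ℂ) * (2 * lam + c))) ^ (1 / 2 : ℂ)

theorem z1_sq (c : ℝ) (lam : ℂ) : z1 c lam ^ 2 = (c : ℂ) * (2 * lam + c) := by
  have h : ((-((c : ℂ) * (2 * lam + c))) ^ (1 / 2 : ℂ)) ^ 2 = -((c : ℂ) * (2 * lam + c)) := by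
    have := Complex.cpow_nat_inv_pow (-((c : ℂ) * (2 * lam + c))) (n := 2) (by norm_num)
    simpa only [one_div, Nat.cast_ofNat] using this
  rw [z1, mul_pow, h, Complex.I_sq]
  ring

theorem z1_im_pos (c : ℝ) (hc : c ≠ 0) (lam : ℂ) (hlam : lam ∈ upperHalf) :
    0 < (z1 c lam).im := by
  have hsq := z1_sq c lam
  have him : ((z1 c lam) ^ 2).im ≠ 0 := by
    rw [hsq]
    have h0 : 0 < lam.im := hlam
    simp [Complex.mul_im, hc, h0.ne']
  have hne : (z1 c lam).im ≠ 0 := by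
    intro h
    apply him
    simp [pow_two, Complex.mul_im, h]
  have hnn : 0 ≤ (z1 c lam).im := by
    have h1 : (z1 c lam).im = ((-((c : ℂ) * (2 * lam + c))) ^ (1 / 2 : ℂ)).re := by
      simp [z1]
    rw [h1]
    set w : ℂ := -((c : ℂ) * (2 * lam + c))
    by_cases hw : w = 0
    · rw [hw, Complex.zero_cpow (by norm_num)]
      simp
    · rw [Complex.cpow_def_of_ne_zero hw, Complex.exp_re]
      refine mul_nonneg (Real.exp_pos _).le (Real.cos_nonneg_of_mem_Icc ?_)
      have h2 : (Complex.log w * (1 / 2 : ℂ)).im = Complex.arg w / 2 := by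
        rw [show (1 / 2 : ℂ) = ((1 / 2 : ℝ) : ℂ) by norm_num, Complex.im_mul_ofReal,
          Complex.log_im]
        ring
      rw [h2]
      constructor
      · linarith [Complex.neg_pi_lt_arg w]
      · linarith [Complex.arg_le_pi w]
  exact lt_of_le_of_ne hnn hne.symm

/-- `E₁(lam) = [-α; lam⁻¹ (lam + c - z₁(lam)) I_p]`. -/
def E1 {p : ℕ} (c : ℝ) (α : Matrix (Fin p) (Fin p) ℂ) (lam : ℂ) :
    Matrix (Fin p ⊕ Fin p) (Fin p) ℂ :=
  Matrix.fromRows (-α) ((1 / lam * (lam + c - z1 c lam)) • (1 : Matrix (Fin p) (Fin p) ℂ))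

end

end CanonicalGBDT

/-! Write `X = Λ* S⁻¹ Λ` and `y` for a solution of the initial system.

Existence is a Darboux transformation. Conjugating the transformed system by `w_A(x,0)`, which is
`j`-unitary, yields the initial system plus a gauge term independent of `lam`, and `w_A(x,lam) y`
solves that same system. With `y` the explicit exponential `decaySol`, uniqueness for linear
equations identifies `w_A(x,0)⁻¹ w_A(x,lam) y` as the solution starting at `v(0,lam) E₁(lam)`
(`transfer_mul_solution`). Its form `w* j w` is positive: `y* j y > 0` because the lower coefficient
of `E₁` has modulus below 1, and `w_A(lam)` only increases the form (`transfer_form`). Since `(w* j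
w)' = -2 Im lam · w* H̃ w`, positivity for all `x` bounds the Weyl integral, and positivity at `x =
0` makes the top block invertible and `φ` contractive. Eigenvalues of `A` in the half-plane are
removable singularities by boundedness; nonnegativity of the form passes to them by continuity in
`lam`, which is why the fundamental solution is built as a power series in the parameter.

Uniqueness: two Weyl values differ by a solution starting at `[0; M₁ - M₂]`, so `J₁ = tr w* j w`
stays below a negative constant, while integrability keeps it bounded below. Put `u = w_A(x,0) w`,
`a = β u`, `b = β j u`; then `∫ |a|² < ∞` and `Re tr a* b = J₁`. The imaginary part satisfies `J₂' =
-c|b|² + O(|a|²)` (`hasMatDeriv_cross`), and `J₁² + J₂² ≤ |a|²|b|²`. These facts are incompatible on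
an infinite interval (`false_of_growth`).

The error `O(|a|²)` needs `β j Λ* S⁻¹ Λ β*` bounded. Here `(Λ j β*, Λ β*)` solves a constant
coefficient system and `S' = (Λ j β*)(Λ j β*)*`. The growth of `S` over a unit window therefore
controls both components at its right end (`exists_entry_bound`, `exists_norm_trace_le`). -/

/-! ### Volterra series for linear equations with a parameter. -/

section Volterra

open Topology Filter

theorem exists_bound_of_continuous {E : Type*} [NormedAddCommGroup E] {K : ℝ → E} (hK : Continuous
    K) (R : ℝ) :
    ∃ C, ∀ x, |x| ≤ R → ‖K x‖ ≤ C := by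
  obtain ⟨C, hC⟩ := isCompact_Icc.exists_bound_of_continuousOn
    (hK.continuousOn (s := Icc (-R) R))
  exact ⟨C, fun x hx => hC x (abs_le.1 hx)⟩

variable {𝔸 : Type*} [NormedRing 𝔸] [NormedAlgebra ℂ 𝔸]

/-- The coefficients of the expansion in powers of `z` of the solution of `W' = z K W`,
`W 0 = 1`. -/
noncomputable def volterraCoeff (K : ℝ → 𝔸) : ℕ → ℝ → 𝔸
  | 0 => fun _ => 1
  | k + 1 => fun x => ∫ t in (0 : ℝ)..x, K t * volterraCoeff K k t

theorem continuous_volterraCoeff {K : ℝ → 𝔸} (hK : Continuous K) (k : ℕ) :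
    Continuous (volterraCoeff K k) := by
  induction k with
  | zero => exact continuous_const
  | succ k ih =>
    exact intervalIntegral.continuous_primitive
      (fun a b => (hK.mul ih).intervalIntegrable a b) 0

theorem hasDerivAt_volterraCoeff_succ [CompleteSpace 𝔸] {K : ℝ → 𝔸} (hK : Continuous K)
    (k : ℕ) (x : ℝ) :
    HasDerivAt (volterraCoeff K (k + 1)) (K x * volterraCoeff K k x) x := by
  have hc := hK.mul (continuous_volterraCoeff hK k)
  exact intervalIntegral.integral_hasDerivAt_right (hc.intervalIntegrable 0 x)
    hc.stronglyMeasurable.stronglyMeasurableAtFilter hc.continuousAt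

/-- Each iterated integral gains a factor `C|x|/(k+1)`. Absolute values cover `x < 0`, and `‖1‖` is
kept because the algebra norm is not assumed to be normalized. -/
theorem norm_volterraCoeff_le {K : ℝ → 𝔸} {C R : ℝ}
    (hC : ∀ x, |x| ≤ R → ‖K x‖ ≤ C) (k : ℕ) :
    ∀ x, |x| ≤ R → ‖volterraCoeff K k x‖ ≤ ‖(1 : 𝔸)‖ * ((C * |x|) ^ k / k.factorial) := by
  induction k with
  | zero => intro x _; simp [volterraCoeff]
  | succ k ih =>
    intro x hx
    have hC0 : 0 ≤ C := (norm_nonneg _).trans (hC x hx)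
    have key : ∀ t ∈ Set.uIoc 0 x, ‖K t * volterraCoeff K k t‖ ≤
        C * (‖(1 : 𝔸)‖ * ((C * |t|) ^ k / k.factorial)) := by
      intro t ht
      have ht' : |t| ≤ |x| := by
        rcases le_total 0 x with h | h
        · rw [uIoc_of_le h] at ht
          rw [abs_of_pos ht.1, abs_of_nonneg h]; exact ht.2
        · rw [uIoc_of_ge h] at ht
          rw [abs_of_nonpos ht.2, abs_of_nonpos h]; linarith [ht.1]
      exact (norm_mul_le _ _).trans (mul_le_mul (hC t (ht'.trans hx)) (ih t (ht'.trans hx))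
        (norm_nonneg _) hC0)
    have h1 := intervalIntegral.norm_integral_le_abs_of_norm_le
      (f := fun t => K t * volterraCoeff K k t)
      (g := fun t => C * (‖(1 : 𝔸)‖ * ((C * |t|) ^ k / k.factorial)))
      (a := 0) (b := x) (μ := volume)
      ((ae_restrict_mem measurableSet_uIoc).mono key)
      (Continuous.intervalIntegrable (by fun_prop) _ _)
    refine h1.trans (le_of_eq ?_)
    have h2 : ∫ t in (0 : ℝ)..x, |t| ^ k = x * |x| ^ k / (k + 1) := by
      rcases le_total 0 x with h | h
      · rw [intervalIntegral.integral_congr (g := fun t => t ^ k), integral_pow, abs_of_nonneg h]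
        · simp [pow_succ]; ring
        · intro t ht; rw [uIcc_of_le h] at ht; simp [abs_of_nonneg ht.1]
      · rw [intervalIntegral.integral_congr (g := fun t => (-1) ^ k * t ^ k),
          intervalIntegral.integral_const_mul, integral_pow, abs_of_nonpos h]
        · simp [pow_succ, neg_pow x]; ring
        · intro t ht
          rw [uIcc_of_ge h] at ht
          simp [abs_of_nonpos ht.2, neg_pow t]
    have h3 : ∫ t in (0 : ℝ)..x, C * (‖(1 : 𝔸)‖ * ((C * |t|) ^ k / k.factorial)) =
        C * (‖(1 : 𝔸)‖ * (C ^ k / k.factorial)) * (x * |x| ^ k / (k + 1)) := by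
      rw [← h2, ← intervalIntegral.integral_const_mul]
      congr 1; ext t; rw [mul_pow]; ring
    have h4 : |x * |x| ^ k / ((k : ℝ) + 1)| = |x| ^ (k + 1) / (k + 1) := by
      rw [abs_div, abs_mul, abs_pow, abs_abs, pow_succ',
        abs_of_pos (by positivity : (0 : ℝ) < (k : ℝ) + 1)]
    rw [h3, abs_mul, h4, Nat.factorial_succ,
      abs_of_nonneg (by positivity : (0 : ℝ) ≤ C * (‖(1 : 𝔸)‖ * (C ^ k / k.factorial)))]
    push_cast
    field_simp
    rw [mul_pow]
    ring

/-- The solution of `W' = z K W`, `W 0 = 1`, as a power series in `z`. -/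
noncomputable def volterraSol (K : ℝ → 𝔸) (z : ℂ) (x : ℝ) : 𝔸 :=
  ∑' k : ℕ, z ^ k • volterraCoeff K k x

theorem summable_volterra_bound (N r C R : ℝ) :
    Summable fun k : ℕ => r ^ k * (N * ((C * R) ^ k / k.factorial)) := by
  refine ((Real.summable_pow_div_factorial (r * (C * R))).mul_left N).congr fun k => ?_
  rw [mul_pow]; ring

theorem norm_volterra_term_le {K : ℝ → 𝔸} {C R : ℝ} (hC : ∀ x, |x| ≤ R → ‖K x‖ ≤ C)
    {z : ℂ} {r : ℝ} (hz : ‖z‖ ≤ r) {x : ℝ} (hx : |x| ≤ R) (k : ℕ) :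
    ‖z ^ k • volterraCoeff K k x‖ ≤ r ^ k * (‖(1 : 𝔸)‖ * ((C * R) ^ k / k.factorial)) := by
  have hC0 : 0 ≤ C := (norm_nonneg _).trans (hC x hx)
  rw [norm_smul, norm_pow]
  have h := norm_volterraCoeff_le hC k x hx
  have h0 := abs_nonneg x
  have hr := (norm_nonneg z).trans hz
  calc _ ≤ r ^ k * (‖(1 : 𝔸)‖ * ((C * |x|) ^ k / k.factorial)) := by gcongr
    _ ≤ _ := by gcongr

theorem volterraSol_zero (K : ℝ → 𝔸) (z : ℂ) : volterraSol K z 0 = 1 := by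
  rw [volterraSol, tsum_eq_single 0]
  · simp [volterraCoeff]
  · intro k hk
    obtain ⟨k, rfl⟩ := Nat.exists_eq_succ_of_ne_zero hk
    simp [volterraCoeff]

variable [CompleteSpace 𝔸]

theorem continuous_volterraSol_param {K : ℝ → 𝔸} (hK : Continuous K) (x : ℝ) :
    Continuous fun z => volterraSol K z x := by
  rw [continuous_iff_continuousAt]
  intro z₀
  obtain ⟨C, hC⟩ := exists_bound_of_continuous hK |x|
  have h : ContinuousOn (fun z => volterraSol K z x) (Metric.ball 0 (‖z₀‖ + 1)) := by
    refine continuousOn_tsum (f := fun k z => z ^ k • volterraCoeff K k x) (u := fun k => (‖z₀‖ +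
        1) ^ k *
      (‖(1 : 𝔸)‖ * ((C * |x|) ^ k / k.factorial)))
      (fun k => ((continuous_id.pow k).smul continuous_const).continuousOn)
      (summable_volterra_bound _ _ _ _) fun k z hz => ?_
    exact norm_volterra_term_le hC (by simpa using (mem_ball_zero_iff.1 hz).le) le_rfl k
  exact h.continuousAt (Metric.isOpen_ball.mem_nhds (by simp))

/-- The series may be differentiated term by term: the differentiated terms are the original ones
shifted by one index and multiplied by `z K`, so the same exponential majorant works. -/
theorem hasDerivAt_volterraSol {K : ℝ → 𝔸} (hK : Continuous K) (z : ℂ) (x : ℝ) :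
    HasDerivAt (volterraSol K z) (z • (K x * volterraSol K z x)) x := by
  obtain ⟨C, hC⟩ := exists_bound_of_continuous hK (|x| + 1)
  set R := |x| + 1
  have hC0 : 0 ≤ C := (norm_nonneg _).trans (hC 0 (by simp only [abs_zero, R]; positivity))
  have hmem : ∀ y ∈ Metric.ball (0 : ℝ) R, |y| ≤ R := fun y hy => by
    simpa using (mem_ball_zero_iff.1 hy).le
  let g' : ℕ → ℝ → 𝔸 := fun k y => match k with
    | 0 => 0
    | k + 1 => z ^ (k + 1) • (K y * volterraCoeff K k y)
  let u : ℕ → ℝ := fun k => match k with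
    | 0 => 0
    | k + 1 => ‖z‖ * C * (‖z‖ ^ k * (‖(1 : 𝔸)‖ * ((C * R) ^ k / k.factorial)))
  have hu : Summable u :=
    (summable_nat_add_iff 1).1 ((summable_volterra_bound _ _ _ _).mul_left _)
  have hx : x ∈ Metric.ball (0 : ℝ) R := by simp [R]
  have hsum : Summable fun k : ℕ => z ^ k • volterraCoeff K k x :=
    Summable.of_norm_bounded (summable_volterra_bound _ _ _ _)
      (norm_volterra_term_le hC le_rfl (hmem x hx))
  have h := hasDerivAt_tsum_of_isPreconnected (𝕜 := ℝ) (t := Metric.ball (0 : ℝ) R)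
    (g := fun k y => z ^ k • volterraCoeff K k y) (g' := g') (u := u) (y₀ := x) (y := x) hu
    Metric.isOpen_ball (convex_ball _ _).isPreconnected ?_ ?_ hx hsum hx
  · have he : ∑' k, g' k x = z • (K x * volterraSol K z x) := by
      have hs : Summable fun k => g' k x := by
        refine (summable_nat_add_iff 1).1 ?_
        refine ((hsum.mul_left (K x)).const_smul z).congr fun k => ?_
        rw [mul_smul_comm, smul_smul, ← pow_succ']
      rw [hs.tsum_eq_zero_add, volterraSol, ← hsum.tsum_mul_left,
        ← (hsum.mul_left _).tsum_const_smul]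
      simp [g', pow_succ', mul_smul]
    rw [← he]
    exact h
  · intro k y _
    cases k with
    | zero => simpa [g', volterraCoeff] using hasDerivAt_const y (1 : 𝔸)
    | succ k => exact (hasDerivAt_volterraCoeff_succ hK k y).const_smul (z ^ (k + 1))
  · intro k y hy
    cases k with
    | zero => simp [g', u]
    | succ k =>
      have h1 := norm_volterra_term_le hC (le_refl ‖z‖) (hmem y hy) k
      calc ‖z ^ (k + 1) • (K y * volterraCoeff K k y)‖
          = ‖z‖ * ‖K y * z ^ k • volterraCoeff K k y‖ := by
            rw [← norm_smul, mul_smul_comm, smul_smul, ← pow_succ']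
        _ ≤ ‖z‖ * (C * (‖z‖ ^ k * (‖(1 : 𝔸)‖ * ((C * R) ^ k / k.factorial)))) := by
            gcongr
            exact (norm_mul_le _ _).trans
              (mul_le_mul (hC y (hmem y hy)) h1 (norm_nonneg _) hC0)
        _ = u (k + 1) := by simp only [u]; ring

end Volterra

/-! ### Calculus of matrix functions on the half-line. -/

namespace CanonicalGBDT

/-- Entrywise derivative of a matrix function along `[0, ∞)`. -/
def HasMatDeriv {m k : Type*} (F : ℝ → Matrix m k ℂ) (F' : Matrix m k ℂ) (x : ℝ) : Prop :=
  ∀ i j, HasDerivWithinAt (fun t => F t i j) (F' i j) (Ici 0) x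

namespace HasMatDeriv

variable {m k l : Type*} {F G : ℝ → Matrix m k ℂ} {F' G' : Matrix m k ℂ} {x : ℝ}

theorem congr_deriv (h : HasMatDeriv F F' x) (e : F' = G') : HasMatDeriv F G' x := e ▸ h

theorem const (A : Matrix m k ℂ) : HasMatDeriv (fun _ => A) 0 x :=
  fun _ _ => hasDerivWithinAt_const _ _ _

theorem sub (hF : HasMatDeriv F F' x) (hG : HasMatDeriv G G' x) :
    HasMatDeriv (fun t => F t - G t) (F' - G') x := fun i j => (hF i j).sub (hG i j)

theorem const_smul (hF : HasMatDeriv F F' x) (z : ℂ) :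
    HasMatDeriv (fun t => z • F t) (z • F') x := fun i j => (hF i j).const_mul z

theorem conjTranspose (hF : HasMatDeriv F F' x) :
    HasMatDeriv (fun t => (F t)ᴴ) F'ᴴ x := fun i j => (hF j i).star

theorem mul [Fintype k] {G : ℝ → Matrix k l ℂ} {G' : Matrix k l ℂ}
    (hF : HasMatDeriv F F' x) (hG : HasMatDeriv G G' x) :
    HasMatDeriv (fun t => F t * G t) (F' * G x + F x * G') x := by
  intro i j
  simp only [Matrix.mul_apply, Matrix.add_apply, ← Finset.sum_add_distrib]
  exact HasDerivWithinAt.fun_sum fun r _ => (hF i r).mul (hG r j)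

theorem const_mul [Fintype k] {G : ℝ → Matrix k l ℂ} {G' : Matrix k l ℂ}
    (A : Matrix m k ℂ) (hG : HasMatDeriv G G' x) :
    HasMatDeriv (fun t => A * G t) (A * G') x :=
  ((const A).mul hG).congr_deriv (by simp)

theorem mul_const [Fintype k] (hF : HasMatDeriv F F' x) (A : Matrix k l ℂ) :
    HasMatDeriv (fun t => F t * A) (F' * A) x :=
  (hF.mul (const A)).congr_deriv (by simp)

theorem trace [Fintype m] {F : ℝ → Matrix m m ℂ} {F' : Matrix m m ℂ} (hF : HasMatDeriv F F' x) :
    HasDerivWithinAt (fun t => (F t).trace) F'.trace (Ici 0) x :=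
  HasDerivWithinAt.fun_sum fun i _ => hF i i

theorem continuousWithinAt (hF : HasMatDeriv F F' x) :
    ContinuousWithinAt F (Ici 0) x :=
  continuousWithinAt_pi.2 fun i => continuousWithinAt_pi.2 fun j => (hF i j).continuousWithinAt

theorem fromRows {n : Type*} {G : ℝ → Matrix n k ℂ} {G' : Matrix n k ℂ}
    (hF : HasMatDeriv F F' x) (hG : HasMatDeriv G G' x) :
    HasMatDeriv (fun t => Matrix.fromRows (F t) (G t)) (Matrix.fromRows F' G') x := by
  rintro (i | i) j
  · exact hF i j
  · exact hG i j

/-- Derivative of the inverse of a matrix function that is invertible on `[0, ∞)`. -/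
theorem inv [Fintype m] [DecidableEq m] {F : ℝ → Matrix m m ℂ} {F' : Matrix m m ℂ}
    (hF : HasMatDeriv F F' x) (hx : 0 ≤ x) (hu : ∀ t, 0 ≤ t → IsUnit (F t).det) :
    HasMatDeriv (fun t => (F t)⁻¹) (-((F x)⁻¹ * F' * (F x)⁻¹)) x := by
  have hc : ContinuousWithinAt (fun t => (F t)⁻¹) (Ici 0) x := by
    have h1 := hF.continuousWithinAt
    have h2 : ContinuousWithinAt (fun t => Ring.inverse (F t).det • (F t).adjugate) (Ici 0) x := by
      have hd : ContinuousWithinAt (fun t => (F t).det) (Ici 0) x :=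
        (continuous_id.matrix_det.continuousAt).comp_continuousWithinAt h1
      have ha : ContinuousWithinAt (fun t => (F t).adjugate) (Ici 0) x :=
        (continuous_id.matrix_adjugate.continuousAt).comp_continuousWithinAt h1
      simp only [Ring.inverse_eq_inv']
      exact (hd.inv₀ (hu x hx).ne_zero).smul ha
    exact h2
  intro i j
  rw [hasDerivWithinAt_iff_tendsto_slope]
  have hs : ∀ r s, Filter.Tendsto (slope (fun t => F t r s) x) (nhdsWithin x (Ici 0 \ {x}))
      (nhds (F' r s)) := fun r s => hasDerivWithinAt_iff_tendsto_slope.1 (hF r s)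
  have hM : Filter.Tendsto (fun t => (Matrix.of fun r s => slope (fun t => F t r s) x t))
      (nhdsWithin x (Ici 0 \ {x})) (nhds F') :=
    tendsto_pi_nhds.2 fun r => tendsto_pi_nhds.2 fun s => hs r s
  have hc' : Filter.Tendsto (fun t => (F t)⁻¹) (nhdsWithin x (Ici 0 \ {x})) (nhds (F x)⁻¹) :=
    hc.mono_left (nhdsWithin_mono _ sdiff_subset)
  -- By `F(t)⁻¹ (F(t) - F(x)) F(x)⁻¹ = F(x)⁻¹ - F(t)⁻¹`, the slope of the inverse is minus the slope
  -- of `F` between the two inverses; continuity of the inverse gives the limit.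
  have hlim : Filter.Tendsto (fun t => -((F t)⁻¹ *
      (Matrix.of fun r s => slope (fun t => F t r s) x t) * (F x)⁻¹))
      (nhdsWithin x (Ici 0 \ {x})) (nhds (-((F x)⁻¹ * F' * (F x)⁻¹))) :=
    ((hc'.mul hM).mul_const _).neg
  have hij := (tendsto_pi_nhds.1 (tendsto_pi_nhds.1 hlim i)) j
  refine hij.congr' ?_
  filter_upwards [self_mem_nhdsWithin] with t ht
  have he : (Matrix.of fun r s => slope (fun t => F t r s) x t) =
      ((t - x : ℝ) : ℂ)⁻¹ • (F t - F x) := by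
    ext r s
    simp [slope_def_module]
  have hut := hu t ht.1
  have hux := hu x hx
  have h3 : (F t)⁻¹ * (F t - F x) * (F x)⁻¹ = (F x)⁻¹ - (F t)⁻¹ := by
    rw [Matrix.mul_sub, Matrix.sub_mul, Matrix.nonsing_inv_mul _ hut, Matrix.one_mul,
      Matrix.mul_assoc, Matrix.mul_nonsing_inv _ hux, Matrix.mul_one]
  rw [he, Matrix.mul_smul, Matrix.smul_mul, h3]
  simp [slope_def_module]
  ring

end HasMatDeriv

/-- A linear differential equation with zero initial value has only the zero solution. -/
theorem eq_zero_of_hasMatDeriv {m k : Type*} [Fintype m] [Fintype k]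
    {K : ℝ → Matrix m m ℂ} (hK : ContinuousOn K (Ici 0)) {y : ℝ → Matrix m k ℂ}
    (hy : ∀ x, 0 ≤ x → HasMatDeriv y (K x * y x) x) (h0 : y 0 = 0) {x : ℝ} (hx : 0 ≤ x) :
    y x = 0 := by
  obtain ⟨C, hC⟩ : ∃ C : ℝ, ∀ t ∈ Icc 0 x, ∀ i j, ‖K t i j‖ ≤ C := by
    have hK' : ContinuousOn (fun t => (fun i j => K t i j : m → m → ℂ)) (Icc 0 x) :=
      hK.mono Icc_subset_Ici_self
    obtain ⟨C, hC⟩ := isCompact_Icc.exists_bound_of_continuousOn hK'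
    exact ⟨C, fun t ht i j => ((norm_le_pi_norm _ j).trans (norm_le_pi_norm _ i)).trans (hC t ht)⟩
  let f : ℝ → m → k → ℂ := fun t i j => y t i j
  let f' : ℝ → m → k → ℂ := fun t i j => (K t * y t) i j
  have hd : ∀ t, 0 ≤ t → HasDerivWithinAt f (f' t) (Ici 0) t := fun t ht =>
    hasDerivWithinAt_pi.2 fun i => hasDerivWithinAt_pi.2 fun j => hy t ht i j
  have hz := eq_zero_of_abs_deriv_le_mul_abs_self_of_eq_zero_right (f := f) (f' := f')
    (K := Fintype.card m * C) (a := 0) (b := x)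
    (fun t ht => ((hd t ht.1).continuousWithinAt).mono Icc_subset_Ici_self)
    (fun t ht => (hd t ht.1).mono (Ici_subset_Ici.2 ht.1)) (by ext i j; simp [f, h0]) ?_ x ⟨hx,
        le_rfl⟩
  · ext i j
    exact congrFun (congrFun hz i) j
  · intro t ht
    have ht' : t ∈ Icc 0 x := ⟨ht.1, ht.2.le⟩
    -- Nonnegativity of `C` is read off from an entry of `K`, so the empty index type is treated
    -- apart.
    rcases isEmpty_or_nonempty m with he | ⟨⟨i₀⟩⟩
    · simp [Subsingleton.elim (f' t) 0]
    have hC0 : 0 ≤ C := (norm_nonneg _).trans (hC t ht' i₀ i₀)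
    refine (pi_norm_le_iff_of_nonneg (by positivity)).2 fun i =>
      (pi_norm_le_iff_of_nonneg (by positivity)).2 fun j => ?_
    calc ‖∑ r, K t i r * y t r j‖ ≤ ∑ r : m, C * ‖f t‖ := by
          refine norm_sum_le_of_le _ fun r _ => ?_
          rw [norm_mul]
          exact mul_le_mul (hC t ht' i r) ((norm_le_pi_norm (f t r) j).trans
            (norm_le_pi_norm (f t) r)) (norm_nonneg _) hC0
      _ = _ := by simp [mul_assoc]

section Existence

attribute [local instance] Matrix.linftyOpNormedRing Matrix.linftyOpNormedAlgebra

/-- Existence of the fundamental solution, with continuous dependence on the parameter. -/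
theorem exists_solution_param {m : Type*} [Fintype m] [DecidableEq m] {K : ℝ → Matrix m m ℂ}
    (hK : ∀ i j, ContinuousOn (fun t => K t i j) (Ici 0)) :
    ∃ W : ℂ → ℝ → Matrix m m ℂ, (∀ z, W z 0 = 1) ∧
      (∀ z x, 0 ≤ x → HasMatDeriv (W z) (z • (K x * W z x)) x) ∧
      ∀ x i j, Continuous fun z => W z x i j := by
  -- Freezing `K` at its value at 0 for negative times gives a kernel continuous on all of `ℝ`, as
  -- the Volterra construction requires.
  let K₁ : ℝ → Matrix m m ℂ := fun t => K (max t 0)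
  have hK₁ : Continuous K₁ := by
    have h1 : ∀ i j, Continuous fun t => K₁ t i j := fun i j =>
      (hK i j).comp_continuous (by fun_prop) fun t => show (0 : ℝ) ≤ max t 0 from le_max_right _ _
    have h2 : K₁ = fun t => ∑ i, ∑ j, (K₁ t i j) • (Matrix.single i j (1 : ℂ)) := by
      ext1 t
      conv_lhs => rw [Matrix.matrix_eq_sum_single (K₁ t)]
      simp [Matrix.smul_single]
    rw [h2]
    exact continuous_finsetSum _ fun i _ => continuous_finsetSum _ fun j _ =>
      (h1 i j).smul continuous_const
  refine ⟨volterraSol K₁, volterraSol_zero K₁, fun z x hx i j => ?_, fun x i j => ?_⟩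
  · let L : Matrix m m ℂ →L[ℝ] ℂ :=
      LinearMap.toContinuousLinearMap (Matrix.entryLinearMap ℝ ℂ i j)
    have h := (L.hasFDerivAt.comp_hasDerivAt x (hasDerivAt_volterraSol hK₁ z x)).hasDerivWithinAt
      (s := Ici 0)
    have he : K₁ x = K x := by simp [K₁, max_eq_left hx]
    rw [he] at h
    exact h
  · let L : Matrix m m ℂ →L[ℝ] ℂ :=
      LinearMap.toContinuousLinearMap (Matrix.entryLinearMap ℝ ℂ i j)
    exact L.continuous.comp (continuous_volterraSol_param hK₁ x)

end Existence

end CanonicalGBDT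

namespace CanonicalGBDT

/-! ### Algebra of the signature matrix and of the transfer function. -/

section Algebra

variable {p n : ℕ}

theorem sig_mul_sig : sig p * sig p = 1 := by
  simp [sig, Matrix.fromBlocks_multiply, ← Matrix.fromBlocks_one]

theorem sig_mul_sig_mul {k : Type*} (B : Matrix (Fin p ⊕ Fin p) k ℂ) :
    sig p * (sig p * B) = B := by
  rw [← Matrix.mul_assoc, sig_mul_sig, Matrix.one_mul]

theorem sig_conjTranspose : (sig p)ᴴ = sig p := by
  simp [sig, Matrix.fromBlocks_conjTranspose]

theorem fromRows_sig_fromRows {q : Type*} (a b : Matrix (Fin p) q ℂ) :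
    (fromRows a b)ᴴ * (sig p * fromRows a b) = aᴴ * a - bᴴ * b := by
  rw [sig, Matrix.fromBlocks_mul_fromRows, Matrix.conjTranspose_fromRows_eq_fromCols_conjTranspose,
    Matrix.fromCols_mul_fromRows]
  simp [sub_eq_add_neg]

/-- The relations between the matrices of a triple. -/
structure IsTriple (A S : Matrix (Fin n) (Fin n) ℂ) (Λ : Matrix (Fin n) (Fin p ⊕ Fin p) ℂ) :
    Prop where
  posDef : S.PosDef
  identity : A * S - S * Aᴴ = Complex.I • (Λ * sig p * Λᴴ)

variable {A S : Matrix (Fin n) (Fin n) ℂ} {Λ : Matrix (Fin n) (Fin p ⊕ Fin p) ℂ}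

namespace IsTriple

theorem isUnit_det (h : IsTriple A S Λ) : IsUnit S.det :=
  (Matrix.isUnit_iff_isUnit_det _).1 h.posDef.isUnit

theorem inv_hermitian (h : IsTriple A S Λ) : (S⁻¹)ᴴ = S⁻¹ :=
  h.posDef.inv.isHermitian

/-- The triple identity multiplied by `S⁻¹` on both sides. It serves to commute `Aᴴ` past `S⁻¹`. -/
theorem identity_inv (h : IsTriple A S Λ) :
    Aᴴ * S⁻¹ = S⁻¹ * A - Complex.I • (S⁻¹ * (Λ * (sig p * (Λᴴ * S⁻¹)))) := by
  have h1 : S⁻¹ * (A * S - S * Aᴴ) * S⁻¹ = S⁻¹ * A - Aᴴ * S⁻¹ := by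
    rw [Matrix.mul_sub, Matrix.sub_mul, ← Matrix.mul_assoc S⁻¹ S, Matrix.nonsing_inv_mul _
        h.isUnit_det,
      Matrix.one_mul, Matrix.mul_assoc, Matrix.mul_assoc, Matrix.mul_nonsing_inv _ h.isUnit_det,
      Matrix.mul_one]
  rw [h.identity] at h1
  simp only [Matrix.mul_smul, Matrix.smul_mul, Matrix.mul_assoc] at h1
  rw [h1]
  abel

/-- `w_A* j w_A = j + 2 Im lam Λ* R* S⁻¹ R Λ` with `R = (A - lam I)⁻¹`. -/
theorem transfer_form (h : IsTriple A S Λ) {lam : ℂ} (hl : (A - lam • 1).det ≠ 0) :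
    (transfer A S Λ lam)ᴴ * (sig p * transfer A S Λ lam) = sig p +
      (2 * lam.im : ℂ) • (((A - lam • 1)⁻¹ * Λ)ᴴ * (S⁻¹ * ((A - lam • 1)⁻¹ * Λ))) := by
  have hR : (A - lam • 1) * (A - lam • 1)⁻¹ = 1 := Matrix.mul_nonsing_inv _ (isUnit_iff_ne_zero.2
      hl)
  set Z := (A - lam • 1)⁻¹ * Λ with hZ
  have hAZ : A * Z = Λ + lam • Z := by
    have : (A - lam • 1) * Z = Λ := by rw [hZ, ← Matrix.mul_assoc, hR, Matrix.one_mul]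
    rw [Matrix.sub_mul, Matrix.smul_mul, Matrix.one_mul] at this
    rw [← this]; abel
  have hZA : Zᴴ * Aᴴ = Λᴴ + star lam • Zᴴ := by
    rw [← Matrix.conjTranspose_mul, hAZ, Matrix.conjTranspose_add, Matrix.conjTranspose_smul]
  have hw : transfer A S Λ lam = 1 - Complex.I • (sig p * (Λᴴ * (S⁻¹ * Z))) := by
    simp only [transfer, hZ, Matrix.mul_assoc]
  -- Sandwiching the inverted identity between `Zᴴ` and `Z`, and using `A Z = Λ + lam Z`, turns the
  -- term quadratic in `S⁻¹` into linear ones. The linear terms cancel those in the expansion of `w*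
  -- j w`.
  have key : Zᴴ * (S⁻¹ * (Λ * (sig p * (Λᴴ * (S⁻¹ * Z))))) =
      -Complex.I • (Zᴴ * (S⁻¹ * Λ) - Λᴴ * (S⁻¹ * Z) + (lam - star lam) • (Zᴴ * (S⁻¹ * Z))) := by
    have h1 : Complex.I • (S⁻¹ * (Λ * (sig p * (Λᴴ * S⁻¹)))) = S⁻¹ * A - Aᴴ * S⁻¹ := by
      rw [h.identity_inv]; abel
    have h2 : Complex.I • (Zᴴ * (S⁻¹ * (Λ * (sig p * (Λᴴ * (S⁻¹ * Z)))))) =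
        Zᴴ * (S⁻¹ * (A * Z)) - (Zᴴ * Aᴴ) * (S⁻¹ * Z) := by
      have := congrArg (fun Y => Zᴴ * Y * Z) h1
      simpa only [Matrix.mul_smul, Matrix.smul_mul, Matrix.mul_assoc, Matrix.mul_sub,
        Matrix.sub_mul] using this
    have h3 := congrArg (fun Y => -Complex.I • Y) h2
    simp only [smul_smul, neg_mul, Complex.I_mul_I, neg_neg, one_smul] at h3
    rw [h3, hAZ, hZA]
    simp only [Matrix.mul_add, Matrix.add_mul, Matrix.mul_smul, Matrix.smul_mul]
    module
  have him : (2 * lam.im : ℂ) = -Complex.I * (lam - star lam) := by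
    apply Complex.ext <;> simp [two_mul]
  rw [hw]
  simp only [Matrix.conjTranspose_sub, Matrix.conjTranspose_one, Matrix.conjTranspose_smul,
    Matrix.conjTranspose_mul, Matrix.conjTranspose_conjTranspose, h.inv_hermitian,
    sig_conjTranspose, Matrix.mul_sub, Matrix.sub_mul, Matrix.mul_one, Matrix.one_mul,
    Matrix.mul_smul, Matrix.smul_mul, Matrix.mul_assoc, sig_mul_sig_mul, sig_mul_sig, key, him]
  have hs : star Complex.I = -Complex.I := Complex.conj_I
  rw [hs]
  match_scalars
  · ring
  · linear_combination Complex.I * Complex.I_sq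
  · linear_combination (-Complex.I) * Complex.I_sq
  · linear_combination Complex.I * (lam - star lam) * Complex.I_sq

/-- The correction in `transfer_form` carries the factor `Im lam`, which vanishes at 0. This
`j`-unitarity is what makes `w_A(x,0)` usable as a gauge factor. -/
theorem transfer_zero_unitary (h : IsTriple A S Λ) (hA : A.det ≠ 0) :
    (transfer A S Λ 0)ᴴ * (sig p * transfer A S Λ 0) = sig p := by
  rw [h.transfer_form (by simpa using hA)]
  simp

theorem transfer_zero_isUnit (h : IsTriple A S Λ) (hA : A.det ≠ 0) :
    IsUnit (transfer A S Λ 0).det := by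
  have h1 : (sig p * (transfer A S Λ 0)ᴴ * sig p) * transfer A S Λ 0 = 1 := by
    rw [Matrix.mul_assoc, Matrix.mul_assoc, h.transfer_zero_unitary hA, sig_mul_sig]
  exact (Matrix.isUnit_iff_isUnit_det _).1 (IsUnit.of_mul_eq_one_right _ h1)

theorem transfer_zero_inv (h : IsTriple A S Λ) (hA : A.det ≠ 0) :
    (transfer A S Λ 0)⁻¹ = sig p * (transfer A S Λ 0)ᴴ * sig p := by
  refine Matrix.inv_eq_left_inv ?_
  rw [Matrix.mul_assoc, Matrix.mul_assoc, h.transfer_zero_unitary hA, sig_mul_sig]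

theorem transfer_zero_mul_sig (h : IsTriple A S Λ) (hA : A.det ≠ 0) :
    transfer A S Λ 0 * sig p * (transfer A S Λ 0)ᴴ = sig p := by
  have h1 := Matrix.mul_nonsing_inv _ (h.transfer_zero_isUnit hA)
  rw [h.transfer_zero_inv hA] at h1
  have h2 := congrArg (· * sig p) h1
  simpa only [Matrix.mul_assoc, sig_mul_sig, Matrix.mul_one, Matrix.one_mul] using h2

end IsTriple

end Algebra

/-! ### Identities for the initial `β`. -/

section Beta

variable {p : ℕ} (c : ℝ) {α : Matrix (Fin p) (Fin p) ℂ}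

theorem conj_exp_mul_ofReal (x : ℝ) :
    (starRingEnd ℂ) (Complex.exp (Complex.I * c * x)) = Complex.exp (-(Complex.I * c * x)) := by
  rw [← Complex.exp_conj]; simp

theorem conj_exp_neg_mul_ofReal (x : ℝ) :
    (starRingEnd ℂ) (Complex.exp (-(Complex.I * c * x))) = Complex.exp (Complex.I * c * x) := by
  rw [← Complex.exp_conj]; simp

theorem beta_conjTranspose (x : ℝ) :
    (beta c α x)ᴴ = fromRows (Complex.exp (-(Complex.I * c * x)) • 1)
      (Complex.exp (Complex.I * c * x) • αᴴ) := by
  rw [beta, Matrix.conjTranspose_fromCols_eq_fromRows_conjTranspose]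
  simp [Matrix.conjTranspose_smul, conj_exp_mul_ofReal, conj_exp_neg_mul_ofReal]

theorem beta_mul_sig (x : ℝ) :
    beta c α x * sig p = fromCols (Complex.exp (Complex.I * c * x) • 1)
      (-(Complex.exp (-(Complex.I * c * x)) • α)) := by
  simp [beta, sig, Matrix.fromCols_mul_fromBlocks]

theorem beta_mul_conjTranspose (hα : α * αᴴ = 1) (x : ℝ) :
    beta c α x * (beta c α x)ᴴ = (2 : ℂ) • 1 := by
  rw [beta_conjTranspose, beta, Matrix.fromCols_mul_fromRows]
  simp only [Matrix.smul_mul, Matrix.mul_smul, hα, Matrix.one_mul, smul_smul, ← Complex.exp_add]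
  simp only [neg_add_cancel, add_neg_cancel, Complex.exp_zero]
  module

theorem beta_mul_sig_mul_conjTranspose (hα : α * αᴴ = 1) (x : ℝ) :
    beta c α x * (sig p * (beta c α x)ᴴ) = 0 := by
  rw [← Matrix.mul_assoc, beta_mul_sig, beta_conjTranspose, Matrix.fromCols_mul_fromRows]
  simp only [Matrix.smul_mul, Matrix.mul_smul, hα, Matrix.one_mul, smul_smul, ← Complex.exp_add,
    Matrix.neg_mul, smul_neg]
  simp

/-- Half of `H` and half of `j H j` are complementary projections: the off-diagonal blocks cancel
and the diagonal ones add up. Hence a vector `u` is determined by `β u` and `β j u`, the two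
components tracked in the uniqueness proof. -/
theorem initHam_add (hα : α * αᴴ = 1) (x : ℝ) :
    initHam c α x + sig p * initHam c α x * sig p = (2 : ℂ) • 1 := by
  have hα' : αᴴ * α = 1 := mul_eq_one_comm.1 hα
  have h1 : sig p * initHam c α x * sig p = (beta c α x * sig p)ᴴ * (beta c α x * sig p) := by
    simp only [initHam, Matrix.conjTranspose_mul, sig_conjTranspose, Matrix.mul_assoc]
  have h2 : (beta c α x * sig p)ᴴ = fromRows (Complex.exp (-(Complex.I * c * x)) • 1)
      (-(Complex.exp (Complex.I * c * x) • αᴴ)) := by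
    rw [beta_mul_sig, Matrix.conjTranspose_fromCols_eq_fromRows_conjTranspose]
    simp [Matrix.conjTranspose_smul, conj_exp_mul_ofReal, conj_exp_neg_mul_ofReal]
  rw [h1, h2, beta_mul_sig, initHam, beta_conjTranspose, beta, Matrix.fromRows_mul_fromCols,
    Matrix.fromRows_mul_fromCols, Matrix.fromBlocks_add]
  simp only [Matrix.smul_mul, Matrix.mul_smul, hα', Matrix.one_mul, Matrix.mul_one, smul_smul,
    ← Complex.exp_add, Matrix.neg_mul, Matrix.mul_neg, smul_neg, neg_neg, add_neg_cancel,
        neg_add_cancel,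
    Complex.exp_zero, one_smul, ← two_smul ℂ (1 : Matrix (Fin p) (Fin p) ℂ)]
  rw [← Matrix.fromBlocks_one, Matrix.fromBlocks_smul]
  simp

theorem hasMatDeriv_beta (x : ℝ) :
    HasMatDeriv (beta c α) ((Complex.I * c) • (beta c α x * sig p)) x := by
  have he : HasDerivAt (fun t : ℝ => Complex.exp (Complex.I * c * t))
      (Complex.exp (Complex.I * c * x) * (Complex.I * c)) x := by
    have := ((Complex.ofRealCLM.hasDerivAt (x := x)).const_mul (Complex.I * c)).cexp
    simpa using this
  have he' : HasDerivAt (fun t : ℝ => Complex.exp (-(Complex.I * c * t)))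
      (Complex.exp (-(Complex.I * c * x)) * -(Complex.I * c)) x := by
    have := ((Complex.ofRealCLM.hasDerivAt (x := x)).const_mul (Complex.I * c)).neg.cexp
    simpa using this
  rw [beta_mul_sig]
  rintro i (k | k)
  · refine ((he.mul_const ((1 : Matrix (Fin p) (Fin p) ℂ) i k)).hasDerivWithinAt
      (s := Ici 0)).congr_deriv ?_
    simp; ring
  · refine ((he'.mul_const (α i k)).hasDerivWithinAt (s := Ici 0)).congr_deriv ?_
    simp; ring

end Beta

end CanonicalGBDT

namespace CanonicalGBDT

theorem HasMatDeriv.re_trace {m : Type*} [Fintype m] {F : ℝ → Matrix m m ℂ} {F' : Matrix m m ℂ}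
    {x : ℝ} (hF : HasMatDeriv F F' x) :
    HasDerivWithinAt (fun t => (F t).trace.re) F'.trace.re (Ici 0) x :=
  Complex.reCLM.hasFDerivAt.comp_hasDerivWithinAt x hF.trace

theorem eq_of_hasMatDeriv_zero {m k : Type*} [Fintype m] [Fintype k] {F : ℝ → Matrix m k ℂ}
    (hF : ∀ x, 0 ≤ x → HasMatDeriv F 0 x) {x : ℝ} (hx : 0 ≤ x) : F x = F 0 := by
  have h := eq_zero_of_hasMatDeriv (K := fun _ => (0 : Matrix m m ℂ)) continuousOn_const
    (y := fun t => F t - F 0)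
    (fun t ht => ((hF t ht).sub (HasMatDeriv.const (F 0))).congr_deriv (by simp)) (by simp) hx
  exact sub_eq_zero.1 h

theorem le_of_hasDerivWithinAt_nonneg {f f' : ℝ → ℝ} {b : ℝ}
    (hf : ∀ x, b ≤ x → HasDerivWithinAt f (f' x) (Ici b) x) (hf' : ∀ x, b ≤ x → 0 ≤ f' x)
    {x y : ℝ} (hy : b ≤ y) (hyx : y ≤ x) : f y ≤ f x := by
  have h := antitoneOn_of_hasDerivWithinAt_nonpos (convex_Ici b) (f := fun t => -f t)
    (f' := fun t => -f' t) (fun t ht => (hf t ht).neg.continuousWithinAt)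
    (fun t ht => ((hf t (interior_subset ht)).neg.mono interior_subset))
    (fun t ht => neg_nonpos.2 (hf' t (interior_subset ht)))
  exact neg_le_neg_iff.1 (h hy (hy.trans hyx : b ≤ x) hyx)

theorem posSemidef_sub_of_hasMatDeriv {m : Type*} [Fintype m] {F F' : ℝ → Matrix m m ℂ}
    (hF : ∀ x, 0 ≤ x → HasMatDeriv F (F' x) x) (hF' : ∀ x, 0 ≤ x → (F' x).PosSemidef)
    (hh : ∀ x, 0 ≤ x → (F x).IsHermitian) {x y : ℝ} (hy : 0 ≤ y) (hyx : y ≤ x) :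
    (F x - F y).PosSemidef := by
  have hH := (hh x (hy.trans hyx)).sub (hh y hy)
  refine Matrix.PosSemidef.of_dotProduct_mulVec_nonneg hH fun v => ?_
  -- Viewing `v` as a one-column matrix turns the quadratic form into a trace, whose derivative is
  -- available.
  set V := Matrix.replicateCol Unit v
  have hv : ∀ M : Matrix m m ℂ, star v ⬝ᵥ (M *ᵥ v) = (Vᴴ * M * V).trace := by
    intro M
    rw [Matrix.mul_assoc]
    simp [V, Matrix.trace, Matrix.mul_apply, dotProduct, Matrix.mulVec]
  have him : (star v ⬝ᵥ ((F x - F y) *ᵥ v)).im = 0 := hH.im_star_dotProduct_mulVec_self v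
  have hre := le_of_hasDerivWithinAt_nonneg (f := fun t => (Vᴴ * F t * V).trace.re)
    (f' := fun t => (Vᴴ * F' t * V).trace.re)
    (fun t ht => (((hF t ht).const_mul Vᴴ).mul_const V).re_trace)
    (fun t ht => (Complex.le_def.1 (((hF' t ht).conjTranspose_mul_mul_same V).trace_nonneg)).1)
    hy hyx
  refine Complex.le_def.2 ⟨?_, by simpa using him.symm⟩
  rw [hv, Matrix.mul_sub, Matrix.sub_mul, Matrix.trace_sub, Complex.sub_re]
  simpa using hre

/-! ### Evolution of the triple and of the transfer function. -/

section GBDT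

variable {p n : ℕ} {c : ℝ} {α : Matrix (Fin p) (Fin p) ℂ}
  {A S₀ : Matrix (Fin n) (Fin n) ℂ} {Λ₀ : Matrix (Fin n) (Fin p ⊕ Fin p) ℂ}
  {Λ : ℝ → Matrix (Fin n) (Fin p ⊕ Fin p) ℂ} {S : ℝ → Matrix (Fin n) (Fin n) ℂ}

theorem initHam_conjTranspose (x : ℝ) : (initHam c α x)ᴴ = initHam c α x := by
  simp [initHam, Matrix.conjTranspose_mul]

theorem neg_I_smul_conjTranspose {m k : Type*} (M : Matrix m k ℂ) :
    (-Complex.I • M)ᴴ = Complex.I • Mᴴ := by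
  rw [Matrix.conjTranspose_smul]; congr 1; simp

namespace IsGBDT

theorem hasMatDeriv_Λ (h : IsGBDT (initHam c α) A S₀ Λ₀ Λ S) {x : ℝ} (hx : 0 ≤ x) :
    HasMatDeriv Λ (-Complex.I • (A * Λ x * sig p * initHam c α x)) x := h.Λ_deriv x hx

theorem hasMatDeriv_S (h : IsGBDT (initHam c α) A S₀ Λ₀ Λ S) {x : ℝ} (hx : 0 ≤ x) :
    HasMatDeriv S (Λ x * sig p * initHam c α x * sig p * (Λ x)ᴴ) x := h.S_deriv x hx

theorem hasMatDeriv_S_gram (h : IsGBDT (initHam c α) A S₀ Λ₀ Λ S) {x : ℝ} (hx : 0 ≤ x) :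
    HasMatDeriv S (Λ x * sig p * (beta c α x)ᴴ * (Λ x * sig p * (beta c α x)ᴴ)ᴴ) x :=
  HasMatDeriv.congr_deriv (h.S_deriv x hx) (by
    simp only [initHam, Matrix.conjTranspose_mul, sig_conjTranspose,
      Matrix.conjTranspose_conjTranspose, Matrix.mul_assoc])

/-- `S'` is a Gram matrix, so `S` stays Hermitian and dominates `S₀ > 0`; the defect in the identity
has zero derivative and vanishes at 0. -/
theorem isTriple (h : IsGBDT (initHam c α) A S₀ Λ₀ Λ S) (h₀ : IsTriple A S₀ Λ₀) {x : ℝ}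
    (hx : 0 ≤ x) : IsTriple A (S x) (Λ x) := by
  have hherm : ∀ x, 0 ≤ x → (S x).IsHermitian := by
    intro x hx
    have h1 := eq_of_hasMatDeriv_zero (F := fun t => (S t)ᴴ - S t)
      (fun t ht => ((h.hasMatDeriv_S_gram ht).conjTranspose.sub (h.hasMatDeriv_S_gram
          ht)).congr_deriv
        (by simp [Matrix.conjTranspose_mul, Matrix.mul_assoc])) hx
    simp only [h.S_zero] at h1
    rw [h₀.posDef.isHermitian.eq, sub_self] at h1
    exact sub_eq_zero.1 h1
  refine ⟨?_, ?_⟩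
  · have h1 := posSemidef_sub_of_hasMatDeriv (fun t ht => h.hasMatDeriv_S_gram ht)
      (fun t _ => Matrix.posSemidef_self_mul_conjTranspose _) hherm le_rfl hx
    have h2 := h₀.posDef.add_posSemidef h1
    rwa [h.S_zero, add_sub_cancel] at h2
  · have h1 := eq_of_hasMatDeriv_zero
      (F := fun t => A * S t - S t * Aᴴ - Complex.I • (Λ t * sig p * (Λ t)ᴴ))
      (fun t ht => by
        have hS := h.hasMatDeriv_S ht
        have hΛ := h.hasMatDeriv_Λ ht
        refine (((hS.const_mul A).sub (hS.mul_const Aᴴ)).sub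
          (((hΛ.mul_const (sig p)).mul hΛ.conjTranspose).const_smul Complex.I)).congr_deriv ?_
        simp only [neg_I_smul_conjTranspose, Matrix.conjTranspose_mul, sig_conjTranspose,
          initHam_conjTranspose, Matrix.mul_assoc, Matrix.smul_mul, Matrix.mul_smul]
        have hI := Complex.I_mul_I
        match_scalars <;> grind) hx
    simp only [h.S_zero, h.Λ_zero, h₀.identity, sub_self] at h1
    exact sub_eq_zero.1 h1

/-- `w_A' = i lam (j H w_A - w_A j H) + (j H j X - j X j H) w_A` with `X = Λ* S⁻¹ Λ`. -/
theorem hasMatDeriv_transfer (h : IsGBDT (initHam c α) A S₀ Λ₀ Λ S) (h₀ : IsTriple A S₀ Λ₀)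
    {lam : ℂ} (hl : (A - lam • 1).det ≠ 0) {x : ℝ} (hx : 0 ≤ x) :
    HasMatDeriv (fun t => transfer A (S t) (Λ t) lam)
      ((Complex.I * lam) • (sig p * initHam c α x * transfer A (S x) (Λ x) lam -
          transfer A (S x) (Λ x) lam * sig p * initHam c α x) +
        (sig p * initHam c α x * sig p * ((Λ x)ᴴ * (S x)⁻¹ * Λ x) -
          sig p * ((Λ x)ᴴ * (S x)⁻¹ * Λ x) * sig p * initHam c α x) *
          transfer A (S x) (Λ x) lam) x := by
  have hS := h.hasMatDeriv_S hx
  have hΛ := h.hasMatDeriv_Λ hx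
  have hP := hS.inv hx fun t ht => (h.isTriple h₀ ht).isUnit_det
  have hD := (HasMatDeriv.const (1 : Matrix (Fin p ⊕ Fin p) (Fin p ⊕ Fin p) ℂ) (x := x)).sub
    (((((hΛ.conjTranspose.const_mul (sig p)).mul hP).mul_const ((A - lam • 1)⁻¹)).mul hΛ).const_smul
      Complex.I)
  refine hD.congr_deriv ?_
  have hAP := (h.isTriple h₀ hx).identity_inv
  have hR1 : (A - lam • 1) * (A - lam • 1)⁻¹ = 1 :=
    Matrix.mul_nonsing_inv _ (isUnit_iff_ne_zero.2 hl)
  have hR2 : (A - lam • 1)⁻¹ * (A - lam • 1) = 1 :=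
    Matrix.nonsing_inv_mul _ (isUnit_iff_ne_zero.2 hl)
  have hHs := initHam_conjTranspose (c := c) (α := α) x
  simp only [transfer]
  set R := (A - lam • 1)⁻¹
  have hAR : A * R = 1 + lam • R := by
    rw [Matrix.sub_mul, Matrix.smul_mul, Matrix.one_mul] at hR1
    rw [← hR1]; abel
  have hRA : R * A = 1 + lam • R := by
    rw [Matrix.mul_sub, Matrix.mul_smul, Matrix.mul_one] at hR2
    rw [← hR2]; abel
  generalize Λ x = L at *
  generalize (S x)⁻¹ = P at *
  generalize initHam c α x = H at *
  -- These three rules move every `A` and `Aᴴ` away from the resolvent and from `S⁻¹`; what remains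
  -- is a linear identity among words in `sig p`, `H`, `L`, `P`, `R` and their adjoints.
  have hAPY : ∀ Y : Matrix (Fin n) (Fin p ⊕ Fin p) ℂ, Aᴴ * (P * Y) =
      P * (A * Y) - Complex.I • (P * (L * (sig p * (Lᴴ * (P * Y))))) := fun Y => by
    rw [← Matrix.mul_assoc, hAP]
    simp only [Matrix.sub_mul, Matrix.smul_mul, Matrix.mul_assoc]
  have hARY : ∀ Y : Matrix (Fin n) (Fin p ⊕ Fin p) ℂ, A * (R * Y) = Y + lam • (R * Y) :=
    fun Y => by
      rw [← Matrix.mul_assoc, hAR]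
      simp only [Matrix.add_mul, Matrix.smul_mul, Matrix.one_mul]
  have hRAY : ∀ Y : Matrix (Fin n) (Fin p ⊕ Fin p) ℂ, R * (A * Y) = Y + lam • (R * Y) :=
    fun Y => by
      rw [← Matrix.mul_assoc, hRA]
      simp only [Matrix.add_mul, Matrix.smul_mul, Matrix.one_mul]
  simp only [neg_I_smul_conjTranspose, Matrix.conjTranspose_mul, sig_conjTranspose, hHs,
    Matrix.mul_assoc, Matrix.smul_mul, Matrix.mul_smul, Matrix.mul_sub, Matrix.sub_mul,
    Matrix.mul_add, Matrix.add_mul, Matrix.mul_one, Matrix.one_mul, Matrix.mul_neg, Matrix.neg_mul,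
    hAPY, hARY, hRAY]
  have hI := Complex.I_mul_I
  match_scalars <;> grind

end IsGBDT

end GBDT

end CanonicalGBDT

namespace CanonicalGBDT

/-! ### The decaying solution of the initial system. -/

section InitialSystem

variable {p : ℕ} {c : ℝ} {α : Matrix (Fin p) (Fin p) ℂ} {lam : ℂ}

theorem ne_zero_of_mem_upperHalf (hl : lam ∈ upperHalf) : lam ≠ 0 := by
  rintro rfl; simp [upperHalf] at hl

/-- The scalar in the lower block of `E₁`. -/
noncomputable def decayCoeff (c : ℝ) (lam : ℂ) : ℂ := 1 / lam * (lam + c - z1 c lam)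

theorem lam_mul_decayCoeff (hl : lam ∈ upperHalf) :
    lam * decayCoeff c lam = lam + c - z1 c lam := by
  rw [decayCoeff, ← mul_assoc, mul_one_div_cancel (ne_zero_of_mem_upperHalf hl), one_mul]

/-- Follows from `z₁² - c² = 2 c lam`. It exhibits the coefficient as the Cayley quotient `(z₁ -
c)/(z₁ + c)`, from which its modulus is estimated. -/
theorem z1_add_mul_decayCoeff (hl : lam ∈ upperHalf) :
    (z1 c lam + c) * decayCoeff c lam = z1 c lam - c := by
  apply mul_left_cancel₀ (ne_zero_of_mem_upperHalf hl)
  linear_combination (z1 c lam + c) * lam_mul_decayCoeff (c := c) hl - z1_sq c lam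

theorem norm_decayCoeff_lt (hc : c ≠ 0) (hl : lam ∈ upperHalf) : ‖decayCoeff c lam‖ < 1 := by
  have hz := z1_im_pos c hc lam hl
  have hl' : 0 < lam.im := hl
  set z := z1 c lam
  have h2 : z.re * z.im = c * lam.im := by
    have := congrArg Complex.im (z1_sq c lam)
    simp [pow_two, Complex.mul_im] at this
    linarith
  -- The imaginary part of `z₁² = c(2 lam + c)` gives `c Re z₁ · Im z₁ = c² Im lam > 0`; then `c Re
  -- z₁ > 0` places `z₁` closer to `c` than to `-c`.
  have hcre : 0 < c * z.re := by
    have h3 : 0 < (c * z.re) * z.im := by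
      have : (c * z.re) * z.im = c ^ 2 * lam.im := by rw [mul_assoc, h2]; ring
      rw [this]; positivity
    exact (pos_iff_pos_of_mul_pos h3).2 hz
  have h4 : ‖z - c‖ ^ 2 < ‖z + c‖ ^ 2 := by
    rw [← Complex.normSq_eq_norm_sq, ← Complex.normSq_eq_norm_sq, Complex.normSq_apply,
      Complex.normSq_apply]
    simp
    nlinarith
  have h5 : ‖z - c‖ < ‖z + c‖ := lt_of_pow_lt_pow_left₀ 2 (norm_nonneg _) h4
  have h6 : ‖z + c‖ * ‖decayCoeff c lam‖ = ‖z - c‖ := by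
    rw [← norm_mul, z1_add_mul_decayCoeff hl]
  have h7 : 0 < ‖z + c‖ := (norm_nonneg _).trans_lt h5
  by_contra hcon
  push Not at hcon
  nlinarith

/-- The decaying solution of the initial canonical system. -/
noncomputable def decaySol (c : ℝ) (α : Matrix (Fin p) (Fin p) ℂ) (lam : ℂ) (x : ℝ) :
    Matrix (Fin p ⊕ Fin p) (Fin p) ℂ :=
  fromRows (-Complex.exp (Complex.I * (z1 c lam - c) * x) • α)
    ((decayCoeff c lam * Complex.exp (Complex.I * (z1 c lam + c) * x)) • 1)

theorem decaySol_zero : decaySol c α lam 0 = E1 c α lam := by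
  simp [decaySol, E1, decayCoeff]

theorem hasDerivAt_exp_ofReal_mul (w : ℂ) (x : ℝ) :
    HasDerivAt (fun t : ℝ => Complex.exp (w * t)) (Complex.exp (w * x) * w) x := by
  simpa using ((Complex.ofRealCLM.hasDerivAt (x := x)).const_mul w).cexp

theorem hasMatDeriv_decaySol (hα : α * αᴴ = 1) (hl : lam ∈ upperHalf) (x : ℝ) :
    HasMatDeriv (decaySol c α lam)
      ((Complex.I * lam) • (sig p * initHam c α x * decaySol c α lam x)) x := by
  have hα' : αᴴ * α = 1 := mul_eq_one_comm.1 hα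
  have e1 : Complex.exp (Complex.I * c * x) * Complex.exp (Complex.I * (z1 c lam - c) * x) =
      Complex.exp (Complex.I * z1 c lam * x) := by rw [← Complex.exp_add]; ring_nf
  have e2 : Complex.exp (-(Complex.I * c * x)) * Complex.exp (Complex.I * (z1 c lam + c) * x) =
      Complex.exp (Complex.I * z1 c lam * x) := by rw [← Complex.exp_add]; ring_nf
  have e3 : Complex.exp (-(Complex.I * c * x)) * Complex.exp (Complex.I * z1 c lam * x) =
      Complex.exp (Complex.I * (z1 c lam - c) * x) := by rw [← Complex.exp_add]; ring_nf
  have e4 : Complex.exp (Complex.I * c * x) * Complex.exp (Complex.I * z1 c lam * x) =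
      Complex.exp (Complex.I * (z1 c lam + c) * x) := by rw [← Complex.exp_add]; ring_nf
  -- The opposite phases in `β` and in the solution leave the single exponential `e^{i z₁ x}`.
  have hβ : beta c α x * decaySol c α lam x =
      ((decayCoeff c lam - 1) * Complex.exp (Complex.I * z1 c lam * x)) • α := by
    rw [beta, decaySol, Matrix.fromCols_mul_fromRows]
    simp only [Matrix.smul_mul, Matrix.mul_smul, Matrix.one_mul, Matrix.mul_one, smul_smul]
    match_scalars
    linear_combination -e1 + decayCoeff c lam * e2
  have h1 : sig p * initHam c α x * decaySol c α lam x =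
      fromRows (((decayCoeff c lam - 1) * Complex.exp (Complex.I * (z1 c lam - c) * x)) • α)
        ((-(decayCoeff c lam - 1) * Complex.exp (Complex.I * (z1 c lam + c) * x)) • 1) := by
    rw [Matrix.mul_assoc, initHam, Matrix.mul_assoc, hβ, beta_conjTranspose, sig,
      Matrix.fromRows_mul, Matrix.fromBlocks_mul_fromRows]
    simp only [Matrix.smul_mul, Matrix.mul_smul, Matrix.one_mul, Matrix.mul_one, smul_smul, hα',
      Matrix.zero_mul]
    congr 1
    · match_scalars
      linear_combination (decayCoeff c lam - 1) * e3
    · match_scalars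
      linear_combination -(decayCoeff c lam - 1) * e4
  have h2 : (Complex.I * lam) • (sig p * initHam c α x * decaySol c α lam x) =
      fromRows (-(Complex.exp (Complex.I * (z1 c lam - c) * x) *
          (Complex.I * (z1 c lam - c))) • α)
        ((decayCoeff c lam * (Complex.exp (Complex.I * (z1 c lam + c) * x) *
          (Complex.I * (z1 c lam + c)))) • 1) := by
    rw [h1]
    ext (i | i) k
    · simp only [Matrix.smul_apply, Matrix.fromRows_apply_inl, smul_eq_mul]
      linear_combination Complex.I * Complex.exp (Complex.I * (z1 c lam - c) * x) * α i k *
        lam_mul_decayCoeff (c := c) hl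
    · simp only [Matrix.smul_apply, Matrix.fromRows_apply_inr, smul_eq_mul]
      linear_combination -Complex.I * Complex.exp (Complex.I * (z1 c lam + c) * x) *
        (1 : Matrix (Fin p) (Fin p) ℂ) i k * (lam_mul_decayCoeff (c := c) hl +
          z1_add_mul_decayCoeff (c := c) hl)
  rw [h2]
  refine HasMatDeriv.fromRows (fun i k => ?_) (fun i k => ?_)
  · exact ((hasDerivAt_exp_ofReal_mul _ x).neg.mul_const (α i k)).hasDerivWithinAt
  · exact (((hasDerivAt_exp_ofReal_mul _ x).const_mul (decayCoeff c lam)).mul_const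
      ((1 : Matrix (Fin p) (Fin p) ℂ) i k)).hasDerivWithinAt

/-- Both blocks decay at the rate `Im z₁`, so the form is `e^{-2 x Im z₁}(1 - |m|²) I` with `m` the
lower coefficient, `|m| < 1`. -/
theorem decaySol_form (hα : α * αᴴ = 1) (hc : c ≠ 0) (hl : lam ∈ upperHalf) (x : ℝ) :
    ((decaySol c α lam x)ᴴ * (sig p * decaySol c α lam x)).PosDef := by
  have hα' : αᴴ * α = 1 := mul_eq_one_comm.1 hα
  have hm := norm_decayCoeff_lt hc hl
  have n1 : ‖Complex.exp (Complex.I * (z1 c lam - c) * x)‖ =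
      Real.exp (-((z1 c lam).im * x)) := by rw [Complex.norm_exp]; simp
  have n2 : ‖Complex.exp (Complex.I * (z1 c lam + c) * x)‖ =
      Real.exp (-((z1 c lam).im * x)) := by rw [Complex.norm_exp]; simp
  have hs : ∀ z : ℂ, star z * z = ((‖z‖ ^ 2 : ℝ) : ℂ) := fun z => by
    rw [← Complex.normSq_eq_norm_sq]; exact (Complex.normSq_eq_conj_mul_self).symm
  have h1 : (decaySol c α lam x)ᴴ * (sig p * decaySol c α lam x) =
      (Real.exp (-((z1 c lam).im * x)) ^ 2 * (1 - ‖decayCoeff c lam‖ ^ 2)) •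
        (1 : Matrix (Fin p) (Fin p) ℂ) := by
    rw [decaySol, fromRows_sig_fromRows]
    simp only [Matrix.conjTranspose_smul, Matrix.smul_mul, Matrix.mul_smul, smul_smul, hα',
      Matrix.conjTranspose_one, Matrix.one_mul]
    rw [mul_comm _ (star _), hs, mul_comm _ (star _), hs, norm_neg, norm_mul, n1, n2]
    ext i k
    simp [Complex.real_smul]
    ring
  rw [h1]
  refine Matrix.PosDef.one.smul ?_
  have : ‖decayCoeff c lam‖ ^ 2 < 1 := by
    nlinarith [norm_nonneg (decayCoeff c lam)]
  have : 0 < 1 - ‖decayCoeff c lam‖ ^ 2 := by linarith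
  positivity

end InitialSystem

end CanonicalGBDT

namespace CanonicalGBDT

theorem continuousOn_matrix_mul {m k l : Type*} [Fintype k] {F : ℝ → Matrix m k ℂ}
    {G : ℝ → Matrix k l ℂ} {s : Set ℝ} (hF : ContinuousOn F s) (hG : ContinuousOn G s) :
    ContinuousOn (fun t => F t * G t) s :=
  (continuous_fst.matrix_mul continuous_snd).comp_continuousOn (hF.prodMk hG)

theorem continuousOn_conjTranspose {m k : Type*} {F : ℝ → Matrix m k ℂ} {s : Set ℝ}
    (hF : ContinuousOn F s) : ContinuousOn (fun t => (F t)ᴴ) s :=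
  (continuous_id.matrix_conjTranspose).comp_continuousOn hF

theorem continuousOn_of_hasMatDeriv {m k : Type*} {F F' : ℝ → Matrix m k ℂ}
    (h : ∀ x, 0 ≤ x → HasMatDeriv F (F' x) x) : ContinuousOn F (Ici 0) :=
  fun x hx => (h x hx).continuousWithinAt

/-! ### Solutions of the transformed system and positivity of their form. -/

section Transformed

variable {p n : ℕ} {c : ℝ} {α : Matrix (Fin p) (Fin p) ℂ}
  {A S₀ : Matrix (Fin n) (Fin n) ℂ} {Λ₀ : Matrix (Fin n) (Fin p ⊕ Fin p) ℂ}
  {Λ : ℝ → Matrix (Fin n) (Fin p ⊕ Fin p) ℂ} {S : ℝ → Matrix (Fin n) (Fin n) ℂ} {lam : ℂ}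

theorem transHam_eq (x : ℝ) : transHam c α A Λ S x =
    (transfer A (S x) (Λ x) 0)ᴴ * initHam c α x * transfer A (S x) (Λ x) 0 := by
  simp only [transHam, betaT, initHam, Matrix.conjTranspose_mul, Matrix.mul_assoc]

theorem continuousOn_initHam : ContinuousOn (initHam c α) (Ici 0) := by
  have h : ContinuousOn (beta c α) (Ici 0) :=
    continuousOn_of_hasMatDeriv fun x _ => hasMatDeriv_beta c x
  exact continuousOn_matrix_mul (continuousOn_conjTranspose h) h

/-- The logarithmic derivative `j H j X - j X j H`, `X = Λ* S⁻¹ Λ`, of `w_A` at `lam = 0`. -/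
noncomputable def gauge (c : ℝ) (α : Matrix (Fin p) (Fin p) ℂ)
    (Λ : ℝ → Matrix (Fin n) (Fin p ⊕ Fin p) ℂ) (S : ℝ → Matrix (Fin n) (Fin n) ℂ) (x : ℝ) :
    Matrix (Fin p ⊕ Fin p) (Fin p ⊕ Fin p) ℂ :=
  sig p * initHam c α x * sig p * ((Λ x)ᴴ * (S x)⁻¹ * Λ x) -
    sig p * ((Λ x)ᴴ * (S x)⁻¹ * Λ x) * sig p * initHam c α x

namespace IsGBDT

theorem continuousOn_gauge (h : IsGBDT (initHam c α) A S₀ Λ₀ Λ S) (h₀ : IsTriple A S₀ Λ₀) :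
    ContinuousOn (gauge c α Λ S) (Ici 0) := by
  have hΛ := continuousOn_of_hasMatDeriv fun x hx => h.hasMatDeriv_Λ hx
  have hP := continuousOn_of_hasMatDeriv fun x hx =>
    (h.hasMatDeriv_S hx).inv hx fun t ht => (h.isTriple h₀ ht).isUnit_det
  have hX := continuousOn_matrix_mul (continuousOn_matrix_mul (continuousOn_conjTranspose hΛ) hP) hΛ
  have hH := continuousOn_initHam (c := c) (α := α)
  have hj : ContinuousOn (fun _ : ℝ => sig p) (Ici 0) := continuousOn_const
  exact (continuousOn_matrix_mul (continuousOn_matrix_mul (continuousOn_matrix_mul hj hH) hj)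
    hX).sub (continuousOn_matrix_mul (continuousOn_matrix_mul (continuousOn_matrix_mul hj hX) hj)
        hH)

theorem hasMatDeriv_transfer_zero (h : IsGBDT (initHam c α) A S₀ Λ₀ Λ S) (h₀ : IsTriple A S₀ Λ₀)
    (hA : A.det ≠ 0) {x : ℝ} (hx : 0 ≤ x) :
    HasMatDeriv (fun t => transfer A (S t) (Λ t) 0)
      (gauge c α Λ S x * transfer A (S x) (Λ x) 0) x :=
  (h.hasMatDeriv_transfer h₀ (lam := 0) (by simpa using hA) hx).congr_deriv (by simp [gauge])

theorem continuousOn_transHam (h : IsGBDT (initHam c α) A S₀ Λ₀ Λ S) (h₀ : IsTriple A S₀ Λ₀)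
    (hA : A.det ≠ 0) : ContinuousOn (transHam c α A Λ S) (Ici 0) := by
  have hw := continuousOn_of_hasMatDeriv fun x hx => h.hasMatDeriv_transfer_zero h₀ hA hx
  have := continuousOn_matrix_mul (continuousOn_matrix_mul (continuousOn_conjTranspose hw)
    (continuousOn_initHam (c := c) (α := α))) hw
  exact this.congr fun x _ => transHam_eq x

/-- A solution `w` of the transformed system gives the solution `w_A(·, 0) w` of the gauge
equivalent system. -/
theorem hasMatDeriv_gauge (h : IsGBDT (initHam c α) A S₀ Λ₀ Λ S) (h₀ : IsTriple A S₀ Λ₀)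
    (hA : A.det ≠ 0) {q : Type*} {w : ℝ → Matrix (Fin p ⊕ Fin p) q ℂ} {x : ℝ} (hx : 0 ≤ x)
    (hw : HasMatDeriv w ((Complex.I * lam) • (sig p * transHam c α A Λ S x * w x)) x) :
    HasMatDeriv (fun t => transfer A (S t) (Λ t) 0 * w t)
      (((Complex.I * lam) • (sig p * initHam c α x) + gauge c α Λ S x) *
        (transfer A (S x) (Λ x) 0 * w x)) x := by
  refine ((h.hasMatDeriv_transfer_zero h₀ hA hx).mul hw).congr_deriv ?_
  have h1 := (h.isTriple h₀ hx).transfer_zero_mul_sig hA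
  -- The identity `w_A(x,0) j w_A(x,0)* = j` carries `j H̃` back to `j H`.
  have h2 : transfer A (S x) (Λ x) 0 * (sig p * transHam c α A Λ S x * w x) =
      sig p * initHam c α x * (transfer A (S x) (Λ x) 0 * w x) := by
    rw [transHam_eq]
    have h3 := congrArg (· * (initHam c α x * (transfer A (S x) (Λ x) 0 * w x))) h1
    simpa only [Matrix.mul_assoc] using h3
  rw [Matrix.mul_smul, h2]
  simp only [Matrix.add_mul, Matrix.smul_mul, Matrix.mul_assoc]
  abel

/-- The solution of the transformed system with initial value `v(0, lam) E₁(lam)`. -/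
theorem transfer_mul_solution (h : IsGBDT (initHam c α) A S₀ Λ₀ Λ S) (h₀ : IsTriple A S₀ Λ₀)
    (hA : A.det ≠ 0) (hα : α * αᴴ = 1) (hl : lam ∈ upperHalf) (hlA : (A - lam • 1).det ≠ 0)
    {w : ℝ → Matrix (Fin p ⊕ Fin p) (Fin p) ℂ}
    (hw : ∀ x, 0 ≤ x →
      HasMatDeriv w ((Complex.I * lam) • (sig p * transHam c α A Λ S x * w x)) x)
    (hw0 : w 0 = darboux A S₀ Λ₀ lam * E1 c α lam) {x : ℝ} (hx : 0 ≤ x) :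
    transfer A (S x) (Λ x) 0 * w x = transfer A (S x) (Λ x) lam * decaySol c α lam x := by
  have hK : ContinuousOn (fun t => (Complex.I * lam) • (sig p * initHam c α t) + gauge c α Λ S t)
      (Ici 0) := by
    have h1 : ContinuousOn (fun t => (Complex.I * lam) • sig p * initHam c α t) (Ici 0) :=
      continuousOn_matrix_mul continuousOn_const continuousOn_initHam
    simp only [Matrix.smul_mul] at h1
    exact h1.add (h.continuousOn_gauge h₀)
  have hd : ∀ t, 0 ≤ t → HasMatDeriv (fun t => transfer A (S t) (Λ t) 0 * w t -
      transfer A (S t) (Λ t) lam * decaySol c α lam t)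
      (((Complex.I * lam) • (sig p * initHam c α t) + gauge c α Λ S t) *
        (transfer A (S t) (Λ t) 0 * w t -
          transfer A (S t) (Λ t) lam * decaySol c α lam t)) t := fun t ht => by
    have h1 := h.hasMatDeriv_gauge h₀ hA ht (hw t ht)
    have h2 := (h.hasMatDeriv_transfer h₀ hlA ht).mul (hasMatDeriv_decaySol (c := c) hα hl t)
    refine (h1.sub h2).congr_deriv ?_
    rw [Matrix.mul_sub]
    congr 1
    rw [← gauge]
    generalize gauge c α Λ S t = g
    simp only [Matrix.add_mul, Matrix.sub_mul, Matrix.smul_mul, Matrix.mul_smul,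
      Matrix.mul_assoc]
    module
  have hz : transfer A (S 0) (Λ 0) 0 * w 0 - transfer A (S 0) (Λ 0) lam * decaySol c α lam 0 = 0 :=
      by
    have hu := h₀.transfer_zero_isUnit hA
    rw [h.S_zero, h.Λ_zero, hw0, decaySol_zero, darboux,
      ← Matrix.mul_assoc, ← Matrix.mul_assoc, Matrix.mul_nonsing_inv _ hu, Matrix.one_mul, sub_self]
  exact sub_eq_zero.1 (eq_zero_of_hasMatDeriv hK hd hz hx)

theorem form_transfer_zero_mul (h : IsGBDT (initHam c α) A S₀ Λ₀ Λ S) (h₀ : IsTriple A S₀ Λ₀)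
    (hA : A.det ≠ 0) {q : Type*} (w : Matrix (Fin p ⊕ Fin p) q ℂ) {x : ℝ} (hx : 0 ≤ x) :
    (transfer A (S x) (Λ x) 0 * w)ᴴ * (sig p * (transfer A (S x) (Λ x) 0 * w)) =
      wᴴ * (sig p * w) := by
  have h1 := congrArg (fun Y => wᴴ * Y * w) ((h.isTriple h₀ hx).transfer_zero_unitary hA)
  simpa only [Matrix.conjTranspose_mul, Matrix.mul_assoc] using h1

/-- By `transfer_form`, passing from `y` to `w_A y` adds to `y* j y > 0` a term that is nonnegative
because `Im lam > 0` and `S⁻¹ > 0`. -/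
theorem form_transfer_mul_decaySol (h : IsGBDT (initHam c α) A S₀ Λ₀ Λ S) (h₀ : IsTriple A S₀ Λ₀)
    (hα : α * αᴴ = 1) (hc : c ≠ 0) (hl : lam ∈ upperHalf)
    (hlA : (A - lam • 1).det ≠ 0) {x : ℝ} (hx : 0 ≤ x) :
    ((transfer A (S x) (Λ x) lam * decaySol c α lam x)ᴴ *
      (sig p * (transfer A (S x) (Λ x) lam * decaySol c α lam x))).PosDef := by
  have hT := h.isTriple h₀ hx
  have h2 : (transfer A (S x) (Λ x) lam * decaySol c α lam x)ᴴ *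
      (sig p * (transfer A (S x) (Λ x) lam * decaySol c α lam x)) =
      (decaySol c α lam x)ᴴ * ((transfer A (S x) (Λ x) lam)ᴴ *
        (sig p * transfer A (S x) (Λ x) lam)) * decaySol c α lam x := by
    simp only [Matrix.conjTranspose_mul, Matrix.mul_assoc]
  rw [h2, hT.transfer_form hlA, Matrix.mul_add, Matrix.add_mul, Matrix.mul_assoc]
  refine (decaySol_form hα hc hl x).add_posSemidef ?_
  have h3 := (hT.posDef.inv.posSemidef.conjTranspose_mul_mul_same
    ((A - lam • 1)⁻¹ * Λ x * decaySol c α lam x)).smul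
    (show (0 : ℝ) ≤ 2 * lam.im from by have : 0 < lam.im := hl; positivity)
  have h4 : (decaySol c α lam x)ᴴ * ((2 * lam.im : ℂ) • (((A - lam • 1)⁻¹ * Λ x)ᴴ *
      ((S x)⁻¹ * ((A - lam • 1)⁻¹ * Λ x)))) * decaySol c α lam x =
      (2 * lam.im) • (((A - lam • 1)⁻¹ * Λ x * decaySol c α lam x)ᴴ * (S x)⁻¹ *
        ((A - lam • 1)⁻¹ * Λ x * decaySol c α lam x)) := by
    simp only [Matrix.conjTranspose_mul, Matrix.mul_assoc, Matrix.mul_smul, Matrix.smul_mul]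
    ext i k
    simp [Complex.real_smul]
  rw [h4]
  exact h3

/-- The initial value `v(0, lam) E₁(lam)` is `j`-positive. -/
theorem form_darboux_mul_E1 (h : IsGBDT (initHam c α) A S₀ Λ₀ Λ S) (h₀ : IsTriple A S₀ Λ₀)
    (hA : A.det ≠ 0) (hα : α * αᴴ = 1) (hc : c ≠ 0) (hl : lam ∈ upperHalf)
    (hlA : (A - lam • 1).det ≠ 0) :
    ((darboux A S₀ Λ₀ lam * E1 c α lam)ᴴ *
      (sig p * (darboux A S₀ Λ₀ lam * E1 c α lam))).PosDef := by
  have h1 := h.form_transfer_mul_decaySol h₀ hα hc hl hlA le_rfl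
  have h2 := h.form_transfer_zero_mul h₀ hA (darboux A S₀ Λ₀ lam * E1 c α lam) le_rfl
  have hu := h₀.transfer_zero_isUnit hA
  rw [← h2]
  simp only [h.S_zero, h.Λ_zero, decaySol_zero] at h1 ⊢
  have h3 : transfer A S₀ Λ₀ 0 * (darboux A S₀ Λ₀ lam * E1 c α lam) =
      transfer A S₀ Λ₀ lam * E1 c α lam := by
    rw [darboux, ← Matrix.mul_assoc, ← Matrix.mul_assoc, Matrix.mul_nonsing_inv _ hu,
      Matrix.one_mul]
  rwa [h3]

end IsGBDT

theorem fromCols_one_zero_mul (N : Matrix (Fin p ⊕ Fin p) (Fin p) ℂ) :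
    (fromCols 1 0 : Matrix (Fin p) (Fin p ⊕ Fin p) ℂ) * N = N.toRows₁ := by
  conv_lhs => rw [← Matrix.fromRows_toRows N, Matrix.fromCols_mul_fromRows]
  simp

theorem fromCols_zero_one_mul (N : Matrix (Fin p ⊕ Fin p) (Fin p) ℂ) :
    (fromCols 0 1 : Matrix (Fin p) (Fin p ⊕ Fin p) ℂ) * N = N.toRows₂ := by
  conv_lhs => rw [← Matrix.fromRows_toRows N, Matrix.fromCols_mul_fromRows]
  simp

/-- With blocks `N₁`, `N₂`, the hypothesis is `N₁*N₁ - N₂*N₂ > 0`, hence `N₁*N₁ > 0`. -/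
theorem isUnit_det_of_form_posDef {N : Matrix (Fin p ⊕ Fin p) (Fin p) ℂ}
    (hN : (Nᴴ * (sig p * N)).PosDef) : IsUnit N.toRows₁.det := by
  rw [← Matrix.fromRows_toRows N, fromRows_sig_fromRows] at hN
  have h1 := hN.add_posSemidef (Matrix.posSemidef_conjTranspose_mul_self N.toRows₂)
  rw [sub_add_cancel] at h1
  have h2 := (Matrix.isUnit_iff_isUnit_det _).1 h1.isUnit
  rw [Matrix.det_mul] at h2
  exact isUnit_of_mul_isUnit_right h2

/-- The candidate for the Weyl function, off the spectrum of `A`. -/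
noncomputable def weylFormula (c : ℝ) (α : Matrix (Fin p) (Fin p) ℂ)
    (A S₀ : Matrix (Fin n) (Fin n) ℂ) (Λ₀ : Matrix (Fin n) (Fin p ⊕ Fin p) ℂ) (lam : ℂ) :
    Matrix (Fin p) (Fin p) ℂ :=
  (darboux A S₀ Λ₀ lam * E1 c α lam).toRows₂ * (darboux A S₀ Λ₀ lam * E1 c α lam).toRows₁⁻¹

namespace IsGBDT

theorem isUnit_det_top (h : IsGBDT (initHam c α) A S₀ Λ₀ Λ S) (h₀ : IsTriple A S₀ Λ₀)
    (hA : A.det ≠ 0) (hα : α * αᴴ = 1) (hc : c ≠ 0) (hl : lam ∈ upperHalf)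
    (hlA : (A - lam • 1).det ≠ 0) :
    IsUnit (darboux A S₀ Λ₀ lam * E1 c α lam).toRows₁.det :=
  isUnit_det_of_form_posDef (h.form_darboux_mul_E1 h₀ hA hα hc hl hlA)

theorem fromRows_one_weylFormula (h : IsGBDT (initHam c α) A S₀ Λ₀ Λ S) (h₀ : IsTriple A S₀ Λ₀)
    (hA : A.det ≠ 0) (hα : α * αᴴ = 1) (hc : c ≠ 0) (hl : lam ∈ upperHalf)
    (hlA : (A - lam • 1).det ≠ 0) :
    fromRows (1 : Matrix (Fin p) (Fin p) ℂ) (weylFormula c α A S₀ Λ₀ lam) = (darboux A S₀ Λ₀ lam *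
        E1 c α lam) *
      (darboux A S₀ Λ₀ lam * E1 c α lam).toRows₁⁻¹ := by
  have hu := h.isUnit_det_top h₀ hA hα hc hl hlA
  rw [weylFormula]
  generalize darboux A S₀ Λ₀ lam * E1 c α lam = N at *
  conv_rhs => rw [← Matrix.fromRows_toRows N, Matrix.fromRows_mul]
  rw [Matrix.toRows₁_fromRows, Matrix.mul_nonsing_inv _ hu]

/-- Off the spectrum of `A`, the form `w* j w` of the Weyl solution is nonnegative. -/
theorem form_weylFormula (h : IsGBDT (initHam c α) A S₀ Λ₀ Λ S) (h₀ : IsTriple A S₀ Λ₀)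
    (hA : A.det ≠ 0) (hα : α * αᴴ = 1) (hc : c ≠ 0) (hl : lam ∈ upperHalf)
    (hlA : (A - lam • 1).det ≠ 0) {W : ℝ → Matrix (Fin p ⊕ Fin p) (Fin p ⊕ Fin p) ℂ}
    (hW0 : W 0 = 1) (hW : ∀ x, 0 ≤ x →
      HasMatDeriv W ((Complex.I * lam) • (sig p * transHam c α A Λ S x * W x)) x)
    {x : ℝ} (hx : 0 ≤ x) :
    ((W x * fromRows (1 : Matrix (Fin p) (Fin p) ℂ) (weylFormula c α A S₀ Λ₀ lam))ᴴ *
      (sig p * (W x * fromRows (1 : Matrix (Fin p) (Fin p) ℂ) (weylFormula c α A S₀ Λ₀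
          lam)))).PosSemidef := by
  rw [h.fromRows_one_weylFormula h₀ hA hα hc hl hlA]
  set N : Matrix (Fin p ⊕ Fin p) (Fin p) ℂ := darboux A S₀ Λ₀ lam * E1 c α lam with hN
  have h1 := h.transfer_mul_solution h₀ hA hα hl hlA (w := fun t => W t * N)
    (fun t ht => ((hW t ht).mul_const N).congr_deriv
      (by simp only [Matrix.smul_mul, Matrix.mul_assoc])) (by simp [hW0, hN]) hx
  have h2 := h.form_transfer_mul_decaySol h₀ hα hc hl hlA hx
  rw [← h1, h.form_transfer_zero_mul h₀ hA _ hx] at h2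
  have h3 := h2.posSemidef.conjTranspose_mul_mul_same N.toRows₁⁻¹
  convert h3 using 1
  simp only [Matrix.conjTranspose_mul, Matrix.mul_assoc]

end IsGBDT

end Transformed

end CanonicalGBDT

/-! ### Integrability of the Weyl density. -/

namespace CanonicalGBDT

theorem integrableOn_of_hasDerivWithinAt {f g : ℝ → ℝ} {κ : ℝ} (hκ : 0 < κ)
    (hf : ContinuousOn f (Ici 0)) (hf0 : ∀ x, 0 ≤ x → 0 ≤ f x)
    (hg : ∀ x, 0 ≤ x → HasDerivWithinAt g (-κ * f x) (Ici 0) x) (hg0 : ∀ x, 0 ≤ x → 0 ≤ g x) :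
    IntegrableOn f (Ici 0) := by
  rw [integrableOn_Ici_iff_integrableOn_Ioi]
  refine integrableOn_Ioi_of_intervalIntegral_norm_bounded (g 0 / κ) 0 (b := fun i : ℝ => i)
    (l := Filter.atTop) (fun i => ?_) Filter.tendsto_id ?_
  · exact ((hf.mono Icc_subset_Ici_self).integrableOn_Icc).mono_set Ioc_subset_Icc_self
  · filter_upwards [Filter.eventually_ge_atTop 0] with b hb
    have hsub : Set.uIcc 0 b ⊆ Ici 0 := by rw [uIcc_of_le hb]; exact Icc_subset_Ici_self
    have h1 : ∫ x in (0 : ℝ)..b, ‖f x‖ = ∫ x in (0 : ℝ)..b, f x :=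
      intervalIntegral.integral_congr fun x hx => by
        simp [abs_of_nonneg (hf0 x (hsub hx))]
    have h2 : ∫ x in (0 : ℝ)..b, -κ * f x = g b - g 0 :=
      intervalIntegral.integral_eq_sub_of_hasDeriv_right
        (fun x hx => ((hg x (hsub hx)).continuousWithinAt).mono hsub)
        (fun x hx => (hg x (by simpa [hb] using hx.1.le)).mono
          (fun y hy => (by simpa [hb] using hx.1.le : (0 : ℝ) ≤ x).trans (le_of_lt hy)))
        ((continuousOn_const.mul (hf.mono hsub)).intervalIntegrable)
    rw [intervalIntegral.integral_const_mul] at h2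
    rw [h1, le_div_iff₀ hκ]
    linarith [hg0 b hb]

/-- Entries of a Gram matrix are bounded by its trace. -/
theorem norm_gram_apply_le {m q : Type*} [Fintype m] [Fintype q] (a : Matrix m q ℂ) (i k : q) :
    ‖(aᴴ * a) i k‖ ≤ (aᴴ * a).trace.re := by
  have hd : ∀ l, ((aᴴ * a) l l).re = ∑ r, ‖a r l‖ ^ 2 := fun l => by
    rw [Matrix.mul_apply, Complex.re_sum]
    refine Finset.sum_congr rfl fun r _ => ?_
    rw [Matrix.conjTranspose_apply, ← Complex.normSq_eq_norm_sq]
    simp [Complex.normSq_apply]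
  have h0 : ∀ l, 0 ≤ ((aᴴ * a) l l).re := fun l => by rw [hd]; positivity
  have hle : ∀ l, ((aᴴ * a) l l).re ≤ (aᴴ * a).trace.re := fun l => by
    rw [Matrix.trace, Complex.re_sum]
    exact Finset.single_le_sum (f := fun l => ((aᴴ * a) l l).re) (fun l _ => h0 l)
      (Finset.mem_univ l)
  have h1 : ‖(aᴴ * a) i k‖ ≤ ∑ r, (‖a r i‖ ^ 2 + ‖a r k‖ ^ 2) / 2 := by
    rw [Matrix.mul_apply]
    refine norm_sum_le_of_le _ fun r _ => ?_
    rw [norm_mul, Matrix.conjTranspose_apply, norm_star]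
    nlinarith [sq_nonneg (‖a r i‖ - ‖a r k‖)]
  rw [← Finset.sum_div, Finset.sum_add_distrib, ← hd, ← hd] at h1
  linarith [hle i, hle k]

section Weyl

variable {p n : ℕ} {c : ℝ} {α : Matrix (Fin p) (Fin p) ℂ}
  {A S₀ : Matrix (Fin n) (Fin n) ℂ} {Λ₀ : Matrix (Fin n) (Fin p ⊕ Fin p) ℂ}
  {Λ : ℝ → Matrix (Fin n) (Fin p ⊕ Fin p) ℂ} {S : ℝ → Matrix (Fin n) (Fin n) ℂ} {lam : ℂ}

theorem transHam_conjTranspose (x : ℝ) :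
    (transHam c α A Λ S x)ᴴ = transHam c α A Λ S x := by
  simp [transHam, Matrix.conjTranspose_mul]

/-- The derivative of `w* j w` along solutions of a canonical system. -/
theorem hasMatDeriv_form {q : Type*} {H : Matrix (Fin p ⊕ Fin p) (Fin p ⊕ Fin p) ℂ} (hH : Hᴴ = H)
    {w : ℝ → Matrix (Fin p ⊕ Fin p) q ℂ} {x : ℝ}
    (hw : HasMatDeriv w ((Complex.I * lam) • (sig p * H * w x)) x) :
    HasMatDeriv (fun t => (w t)ᴴ * (sig p * w t))
      ((-(2 * lam.im) : ℂ) • ((w x)ᴴ * (H * w x))) x := by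
  refine (hw.conjTranspose.mul (hw.const_mul (sig p))).congr_deriv ?_
  have him : (-(2 * lam.im) : ℂ) = star (Complex.I * lam) + Complex.I * lam := by
    apply Complex.ext <;> simp [two_mul]
  rw [him]
  simp only [Matrix.conjTranspose_smul, Matrix.conjTranspose_mul, hH, sig_conjTranspose,
    Matrix.smul_mul, Matrix.mul_smul, Matrix.mul_assoc, sig_mul_sig_mul]
  module

theorem weylDensity_eq (H W : Matrix (Fin p ⊕ Fin p) (Fin p ⊕ Fin p) ℂ)
    (M : Matrix (Fin p) (Fin p) ℂ) :
    weylDensity H W M = (W * fromRows (1 : Matrix (Fin p) (Fin p) ℂ) M)ᴴ *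
      (H * (W * fromRows (1 : Matrix (Fin p) (Fin p) ℂ) M)) := by
  simp only [weylDensity, Matrix.conjTranspose_mul, Matrix.mul_assoc]

theorem weylDensity_transHam (x : ℝ) (W : Matrix (Fin p ⊕ Fin p) (Fin p ⊕ Fin p) ℂ)
    (M : Matrix (Fin p) (Fin p) ℂ) :
    weylDensity (transHam c α A Λ S x) W M =
      (betaT c α A Λ S x * (W * fromRows (1 : Matrix (Fin p) (Fin p) ℂ) M))ᴴ *
      (betaT c α A Λ S x * (W * fromRows (1 : Matrix (Fin p) (Fin p) ℂ) M)) := by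
  simp only [weylDensity_eq, transHam, Matrix.conjTranspose_mul, Matrix.mul_assoc]

theorem IsFundamentalSolution.hasMatDeriv
    {H W : ℝ → Matrix (Fin p ⊕ Fin p) (Fin p ⊕ Fin p) ℂ} (h : IsFundamentalSolution H lam W)
    {x : ℝ} (hx : 0 ≤ x) : HasMatDeriv W ((Complex.I * lam) • (sig p * H x * W x)) x := h.2 x hx

theorem IsFundamentalSolution.hasMatDeriv_mul
    {H W : ℝ → Matrix (Fin p ⊕ Fin p) (Fin p ⊕ Fin p) ℂ} (h : IsFundamentalSolution H lam W)
    {q : Type*} (N : Matrix (Fin p ⊕ Fin p) q ℂ) {x : ℝ} (hx : 0 ≤ x) :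
    HasMatDeriv (fun t => W t * N) ((Complex.I * lam) • (sig p * H x * (W x * N))) x :=
  ((h.hasMatDeriv hx).mul_const N).congr_deriv
    (by simp only [Matrix.smul_mul, Matrix.mul_assoc])

namespace IsGBDT

/-- The trace of the density is, up to the factor `-2 Im lam`, the derivative of a nonnegative
function, so its integral is finite. The density is a Gram matrix, so its trace dominates every
entry. -/
theorem integrableOn_weylDensity (h : IsGBDT (initHam c α) A S₀ Λ₀ Λ S) (h₀ : IsTriple A S₀ Λ₀)
    (hA : A.det ≠ 0) (hl : lam ∈ upperHalf) {W : ℝ → Matrix (Fin p ⊕ Fin p) (Fin p ⊕ Fin p) ℂ}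
    (hW : IsFundamentalSolution (transHam c α A Λ S) lam W) {M : Matrix (Fin p) (Fin p) ℂ}
    (hM : ∀ x, 0 ≤ x → 0 ≤ ((W x * fromRows (1 : Matrix (Fin p) (Fin p) ℂ) M)ᴴ *
      (sig p * (W x * fromRows (1 : Matrix (Fin p) (Fin p) ℂ) M))).trace.re) (i k : Fin p) :
    IntegrableOn (fun x => weylDensity (transHam c α A Λ S x) (W x) M i k) (Ici 0) := by
  have hl' : 0 < lam.im := hl
  have hw := fun x (hx : (0 : ℝ) ≤ x) =>
    hW.hasMatDeriv_mul (fromRows (1 : Matrix (Fin p) (Fin p) ℂ) M) hx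
  have hwc := continuousOn_of_hasMatDeriv hw
  have hDc : ContinuousOn (fun x => weylDensity (transHam c α A Λ S x) (W x) M) (Ici 0) := by
    simp only [weylDensity_eq]
    exact continuousOn_matrix_mul (continuousOn_conjTranspose hwc)
      (continuousOn_matrix_mul (h.continuousOn_transHam h₀ hA) hwc)
  have hDik : ∀ i k, ContinuousOn (fun x => weylDensity (transHam c α A Λ S x) (W x) M i k)
      (Ici 0) := fun i k => continuousOn_pi.1 (continuousOn_pi.1 hDc i) k
  have htr : IntegrableOn (fun x => (weylDensity (transHam c α A Λ S x) (W x) M).trace.re)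
      (Ici 0) := by
    refine integrableOn_of_hasDerivWithinAt (κ := 2 * lam.im) (by positivity) ?_ ?_
      (fun x hx => (hasMatDeriv_form (transHam_conjTranspose x) (hw x hx)).re_trace.congr_deriv ?_)
      hM
    · exact Complex.continuous_re.comp_continuousOn
        (continuousOn_finsetSum _ fun i _ => hDik i i)
    · intro x _
      rw [weylDensity_transHam]
      exact (Complex.le_def.1 (Matrix.posSemidef_conjTranspose_mul_self _).trace_nonneg).1
    · rw [weylDensity_eq, Matrix.trace_smul]
      simp
  refine Integrable.mono' htr ((hDik i k).aestronglyMeasurable measurableSet_Ici) ?_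
  refine (ae_of_all _ fun x => ?_)
  rw [weylDensity_transHam]
  exact norm_gram_apply_le _ i k

end IsGBDT

end Weyl

/-! ### Holomorphy and extension over the eigenvalues of `A`. -/

section Holomorphy

theorem differentiableAt_det {m : Type*} [Fintype m] [DecidableEq m] {F : ℂ → Matrix m m ℂ} {z : ℂ}
    (hF : ∀ i j, DifferentiableAt ℂ (fun w => F w i j) z) :
    DifferentiableAt ℂ (fun w => (F w).det) z := by
  simp only [Matrix.det_apply]
  exact DifferentiableAt.fun_sum fun σ _ =>
    (DifferentiableAt.fun_finsetProd fun i _ => hF _ _).const_smul _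

theorem differentiableAt_inv {m : Type*} [Fintype m] [DecidableEq m] {F : ℂ → Matrix m m ℂ} {z : ℂ}
    (hF : ∀ i j, DifferentiableAt ℂ (fun w => F w i j) z) (hz : (F z).det ≠ 0) (i j : m) :
    DifferentiableAt ℂ (fun w => (F w)⁻¹ i j) z := by
  simp only [Matrix.inv_def, Ring.inverse_eq_inv', Matrix.smul_apply, smul_eq_mul,
    Matrix.adjugate_apply]
  refine ((differentiableAt_det hF).inv hz).mul (differentiableAt_det fun r s => ?_)
  simp only [Matrix.updateRow_apply]
  split_ifs
  · exact differentiableAt_const _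
  · exact hF r s

theorem differentiableAt_mul {m k l : Type*} [Fintype k] {F : ℂ → Matrix m k ℂ}
    {G : ℂ → Matrix k l ℂ} {z : ℂ} (hF : ∀ i j, DifferentiableAt ℂ (fun w => F w i j) z)
    (hG : ∀ i j, DifferentiableAt ℂ (fun w => G w i j) z) (i : m) (j : l) :
    DifferentiableAt ℂ (fun w => (F w * G w) i j) z := by
  simp only [Matrix.mul_apply]
  exact DifferentiableAt.fun_sum fun r _ => (hF i r).mul (hG r j)

variable {p n : ℕ} {c : ℝ} {α : Matrix (Fin p) (Fin p) ℂ}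
  {A S₀ : Matrix (Fin n) (Fin n) ℂ} {Λ₀ : Matrix (Fin n) (Fin p ⊕ Fin p) ℂ}
  {Λ : ℝ → Matrix (Fin n) (Fin p ⊕ Fin p) ℂ} {S : ℝ → Matrix (Fin n) (Fin n) ℂ} {lam : ℂ}

theorem differentiableAt_z1 (hc : c ≠ 0) (hl : lam ∈ upperHalf) :
    DifferentiableAt ℂ (z1 c) lam := by
  have hl' : 0 < lam.im := hl
  unfold z1
  refine (DifferentiableAt.cpow_const (by fun_prop) ?_).const_mul _
  refine Complex.mem_slitPlane_iff.2 (Or.inr ?_)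
  simp [hc, hl'.ne']

theorem differentiableAt_darboux_mul_E1 (hc : c ≠ 0) (hl : lam ∈ upperHalf)
    (hlA : (A - lam • 1).det ≠ 0) (i : Fin p ⊕ Fin p) (k : Fin p) :
    DifferentiableAt ℂ (fun z => (darboux A S₀ Λ₀ z * E1 c α z) i k) lam := by
  have hconst : ∀ {m k : Type} (B : Matrix m k ℂ) i j,
      DifferentiableAt ℂ (fun _ : ℂ => B i j) lam := fun B i j => differentiableAt_const _
  have hAz : ∀ i j, DifferentiableAt ℂ (fun z : ℂ => (A - z • 1) i j) lam := fun i j => by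
    simp only [Matrix.sub_apply, Matrix.smul_apply, smul_eq_mul]
    fun_prop
  have hT : ∀ i j, DifferentiableAt ℂ (fun z => transfer A S₀ Λ₀ z i j) lam := fun i j => by
    simp only [transfer, Matrix.sub_apply, Matrix.smul_apply, smul_eq_mul]
    exact (differentiableAt_const _).sub ((differentiableAt_mul (differentiableAt_mul
      (hconst _) (differentiableAt_inv hAz hlA)) (hconst _) i j).const_mul _)
  refine differentiableAt_mul (differentiableAt_mul (hconst _) hT) (fun i j => ?_) i k
  rcases i with i | i
  · exact differentiableAt_const _
  · simp only [E1, Matrix.fromRows_apply_inr, Matrix.smul_apply, smul_eq_mul]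
    have h0 := ne_zero_of_mem_upperHalf hl
    have hz := differentiableAt_z1 (lam := lam) hc hl
    fun_prop (disch := assumption)

theorem IsGBDT.differentiableAt_weylFormula (h : IsGBDT (initHam c α) A S₀ Λ₀ Λ S)
    (h₀ : IsTriple A S₀ Λ₀) (hA : A.det ≠ 0) (hα : α * αᴴ = 1) (hc : c ≠ 0) (hl : lam ∈ upperHalf)
    (hlA : (A - lam • 1).det ≠ 0) (i k : Fin p) :
    DifferentiableAt ℂ (fun z => weylFormula c α A S₀ Λ₀ z i k) lam := by
  have hN := differentiableAt_darboux_mul_E1 (α := α) (A := A) (S₀ := S₀) (Λ₀ := Λ₀) hc hl hlA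
  exact differentiableAt_mul (fun i j => hN (Sum.inr i) j)
    (differentiableAt_inv (fun i j => hN (Sum.inl i) j)
      (h.isUnit_det_top h₀ hA hα hc hl hlA).ne_zero) i k

theorem finite_setOf_det_eq_zero (A : Matrix (Fin n) (Fin n) ℂ) :
    {z : ℂ | (A - z • 1).det = 0}.Finite := by
  refine (Polynomial.finite_setOfPred_isRoot A.charpoly_monic.ne_zero).subset fun z hz => ?_
  have h1 : Matrix.scalar (Fin n) z - A = -(A - z • 1) := by
    rw [neg_sub, Matrix.smul_one_eq_diagonal]; rfl
  have hz' : (A - z • 1).det = 0 := hz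
  rw [Set.mem_ofPred_eq, Polynomial.IsRoot, Matrix.eval_charpoly, h1, Matrix.det_neg, hz', mul_zero]

theorem eventually_det_ne_zero (A : Matrix (Fin n) (Fin n) ℂ) (z₀ : ℂ) :
    ∀ᶠ z in nhdsWithin z₀ {z₀}ᶜ, (A - z • 1).det ≠ 0 := by
  have h1 : ({z : ℂ | (A - z • 1).det = 0} \ {z₀})ᶜ ∈ nhds z₀ :=
    ((finite_setOf_det_eq_zero A).subset sdiff_subset).isClosed.isOpen_compl.mem_nhds (by simp)
  filter_upwards [nhdsWithin_le_nhds h1, self_mem_nhdsWithin] with z hz hz' h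
  exact hz ⟨h, hz'⟩

open Classical in
/-- The Weyl function: the explicit formula, extended over the eigenvalues of `A` by taking
limits. -/
noncomputable def weylExt (c : ℝ) (α : Matrix (Fin p) (Fin p) ℂ)
    (A S₀ : Matrix (Fin n) (Fin n) ℂ) (Λ₀ : Matrix (Fin n) (Fin p ⊕ Fin p) ℂ) (lam : ℂ) :
    Matrix (Fin p) (Fin p) ℂ :=
  if (A - lam • 1).det ≠ 0 then weylFormula c α A S₀ Λ₀ lam else
    Matrix.of fun i k => Filter.limUnder (nhdsWithin lam {lam}ᶜ) fun z => weylFormula c α A S₀ Λ₀ z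
        i k

theorem weylExt_of_det_ne_zero (hlA : (A - lam • 1).det ≠ 0) :
    weylExt c α A S₀ Λ₀ lam = weylFormula c α A S₀ Λ₀ lam := if_pos hlA

namespace IsGBDT

theorem exists_fundamentalSolution (h : IsGBDT (initHam c α) A S₀ Λ₀ Λ S) (h₀ : IsTriple A S₀ Λ₀)
    (hA : A.det ≠ 0) : ∃ W : ℂ → ℝ → Matrix (Fin p ⊕ Fin p) (Fin p ⊕ Fin p) ℂ,
      (∀ z, IsFundamentalSolution (transHam c α A Λ S) z (W z)) ∧
      ∀ x i k, Continuous fun z => W z x i k := by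
  have hK : ContinuousOn (fun t => Complex.I • sig p * transHam c α A Λ S t) (Ici 0) :=
    continuousOn_matrix_mul continuousOn_const (h.continuousOn_transHam h₀ hA)
  obtain ⟨W, h1, h2, h3⟩ := exists_solution_param
    (fun i j => continuousOn_pi.1 (continuousOn_pi.1 hK i) j)
  refine ⟨W, fun z => ⟨h1 z, fun x hx => ?_⟩, h3⟩
  refine HasMatDeriv.congr_deriv (h2 z x hx) ?_
  simp only [Matrix.smul_mul, smul_smul, mul_comm]

/-- At `x = 0` the nonnegative form reads `I - φ*φ`, so `φ` is a contraction. This is the bound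
needed to remove the singularities. -/
theorem norm_weylFormula_le (h : IsGBDT (initHam c α) A S₀ Λ₀ Λ S) (h₀ : IsTriple A S₀ Λ₀)
    (hA : A.det ≠ 0) (hα : α * αᴴ = 1) (hc : c ≠ 0) (hl : lam ∈ upperHalf)
    (hlA : (A - lam • 1).det ≠ 0) (i k : Fin p) : ‖weylFormula c α A S₀ Λ₀ lam i k‖ ≤ 1 := by
  obtain ⟨W, hW, -⟩ := h.exists_fundamentalSolution h₀ hA
  have h1 := h.form_weylFormula h₀ hA hα hc hl hlA (hW lam).1
    (fun x hx => (hW lam).hasMatDeriv hx) le_rfl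
  rw [(hW lam).1, Matrix.one_mul, fromRows_sig_fromRows] at h1
  have h2 := (Complex.le_def.1 (h1.diag_nonneg (i := k))).1
  generalize weylFormula c α A S₀ Λ₀ lam = M at *
  have h3 : ((Mᴴ * M) k k).re = ∑ r, ‖M r k‖ ^ 2 := by
    rw [Matrix.mul_apply, Complex.re_sum]
    refine Finset.sum_congr rfl fun r _ => ?_
    rw [Matrix.conjTranspose_apply, ← Complex.normSq_eq_norm_sq]
    simp [Complex.normSq_apply]
  have h4 : ‖M i k‖ ^ 2 ≤ ∑ r, ‖M r k‖ ^ 2 :=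
    Finset.single_le_sum (f := fun r => ‖M r k‖ ^ 2) (fun r _ => by positivity) (Finset.mem_univ i)
  simp [h3] at h2
  exact (sq_le_one_iff₀ (norm_nonneg _)).1 (h4.trans h2)

theorem differentiableAt_weylExt (h : IsGBDT (initHam c α) A S₀ Λ₀ Λ S) (h₀ : IsTriple A S₀ Λ₀)
    (hA : A.det ≠ 0) (hα : α * αᴴ = 1) (hc : c ≠ 0) (hl : lam ∈ upperHalf) (i k : Fin p) :
    DifferentiableAt ℂ (fun z => weylExt c α A S₀ Λ₀ z i k) lam := by
  set f : ℂ → ℂ := fun z => weylFormula c α A S₀ Λ₀ z i k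
  have hopen : IsOpen upperHalf := isOpen_lt continuous_const Complex.continuous_im
  -- A neighbourhood of `lam` containing no eigenvalue of `A` other than possibly `lam` itself.
  set s : Set ℂ := upperHalf ∩ ({z : ℂ | (A - z • 1).det = 0} \ {lam})ᶜ
  have hs : s ∈ nhds lam := Filter.inter_mem (hopen.mem_nhds hl)
    (((finite_setOf_det_eq_zero A).subset sdiff_subset).isClosed.isOpen_compl.mem_nhds (by simp))
  have hne : ∀ z ∈ s, z ≠ lam → (A - z • 1).det ≠ 0 := fun z hz hz' h0 => hz.2 ⟨h0, hz'⟩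
  by_cases hlA : (A - lam • 1).det = 0
  · have hd : DifferentiableOn ℂ f (s \ {lam}) := fun z hz =>
      (h.differentiableAt_weylFormula h₀ hA hα hc hz.1.1 (hne z hz.1 hz.2) i
          k).differentiableWithinAt
    have hb : BddAbove (norm ∘ f '' (s \ {lam})) := by
      refine ⟨1, ?_⟩
      rintro _ ⟨z, hz, rfl⟩
      exact h.norm_weylFormula_le h₀ hA hα hc hz.1.1 (hne z hz.1 hz.2) i k
    have h1 := (Complex.differentiableOn_update_limUnder_of_bddAbove hs hd hb).differentiableAt hs
    refine h1.congr_of_eventuallyEq ?_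
    filter_upwards [hs] with z hz
    by_cases hzl : z = lam
    · subst hzl
      rw [Function.update_self, weylExt, if_neg (not_not.2 hlA)]
      rfl
    · rw [Function.update_of_ne hzl, weylExt_of_det_ne_zero (hne z hz hzl)]
  · refine (h.differentiableAt_weylFormula h₀ hA hα hc hl hlA i k).congr_of_eventuallyEq ?_
    filter_upwards [hs] with z hz
    by_cases hzl : z = lam
    · subst hzl; rw [weylExt_of_det_ne_zero hlA]
    · rw [weylExt_of_det_ne_zero (hne z hz hzl)]

/-- At an eigenvalue of `A` the transfer function is unavailable, so the inequality is obtained as a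
limit from punctured neighbourhoods, by continuity of `W` and `φ` in the parameter. -/
theorem form_weylExt (h : IsGBDT (initHam c α) A S₀ Λ₀ Λ S) (h₀ : IsTriple A S₀ Λ₀)
    (hA : A.det ≠ 0) (hα : α * αᴴ = 1) (hc : c ≠ 0) (hl : lam ∈ upperHalf)
    {W : ℂ → ℝ → Matrix (Fin p ⊕ Fin p) (Fin p ⊕ Fin p) ℂ}
    (hW : ∀ z, IsFundamentalSolution (transHam c α A Λ S) z (W z))
    (hWc : ∀ x i k, Continuous fun z => W z x i k) {x : ℝ} (hx : 0 ≤ x) :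
    0 ≤ ((W lam x * fromRows (1 : Matrix (Fin p) (Fin p) ℂ) (weylExt c α A S₀ Λ₀ lam))ᴴ *
      (sig p * (W lam x *
        fromRows (1 : Matrix (Fin p) (Fin p) ℂ) (weylExt c α A S₀ Λ₀ lam)))).trace.re := by
  have hopen : IsOpen upperHalf := isOpen_lt continuous_const Complex.continuous_im
  have hcW : ContinuousAt (fun z => W z x) lam :=
    continuousAt_pi.2 fun i => continuousAt_pi.2 fun k => (hWc x i k).continuousAt
  have hcF : ContinuousAt (fun z => fromRows (1 : Matrix (Fin p) (Fin p) ℂ)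
      (weylExt c α A S₀ Λ₀ z)) lam := by
    refine continuousAt_pi.2 fun i => continuousAt_pi.2 fun k => ?_
    rcases i with i | i
    · exact continuousAt_const
    · exact (h.differentiableAt_weylExt h₀ hA hα hc hl i k).continuousAt
  have hcont : Continuous fun P : Matrix (Fin p ⊕ Fin p) (Fin p ⊕ Fin p) ℂ ×
      Matrix (Fin p ⊕ Fin p) (Fin p) ℂ =>
      ((P.1 * P.2)ᴴ * (sig p * (P.1 * P.2))).trace.re := by
    have h1 : Continuous fun P : Matrix (Fin p ⊕ Fin p) (Fin p ⊕ Fin p) ℂ ×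
      Matrix (Fin p ⊕ Fin p) (Fin p) ℂ => P.1 * P.2 := continuous_fst.matrix_mul continuous_snd
    exact Complex.continuous_re.comp
      ((h1.matrix_conjTranspose.matrix_mul (continuous_const.matrix_mul h1)).matrix_trace)
  have hlim := (hcont.continuousAt.comp (hcW.prodMk hcF)).continuousWithinAt (s := {lam}ᶜ)
  refine ge_of_tendsto (b := 0) hlim ?_
  filter_upwards [eventually_det_ne_zero A lam, nhdsWithin_le_nhds (hopen.mem_nhds hl)] with z hz
      hzu
  have h1 := h.form_weylFormula h₀ hA hα hc hzu hz (hW z).1 (fun x hx => (hW z).hasMatDeriv hx) hx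
  rw [← weylExt_of_det_ne_zero hz] at h1
  exact (Complex.le_def.1 h1.trace_nonneg).1

theorem isWeylFunction_weylExt (h : IsGBDT (initHam c α) A S₀ Λ₀ Λ S) (h₀ : IsTriple A S₀ Λ₀)
    (hA : A.det ≠ 0) (hα : α * αᴴ = 1) (hc : c ≠ 0) :
    IsWeylFunction (transHam c α A Λ S) (weylExt c α A S₀ Λ₀) := by
  obtain ⟨W, hW, hWc⟩ := h.exists_fundamentalSolution h₀ hA
  refine ⟨fun i k z hz => (h.differentiableAt_weylExt h₀ hA hα hc hz i k).differentiableWithinAt,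
    fun z hz => ⟨W z, hW z, fun i k => h.integrableOn_weylDensity h₀ hA hz (hW z) (fun x hx => ?_)
      i k⟩⟩
  exact h.form_weylExt h₀ hA hα hc hz hW hWc hx

end IsGBDT

end Holomorphy

end CanonicalGBDT

/-! ### Window estimates for constant coefficient systems and the bound on the error term. -/

namespace CanonicalGBDT

theorem mem_of_hasDerivAt {E : Type*} [NormedAddCommGroup E] [NormedSpace ℝ E]
    [FiniteDimensional ℝ E] {U : Submodule ℝ E} {f : ℝ → E} {f' : E} {a b s : ℝ} (hab : a < b)
    (hs : s ∈ Icc a b) (hf : ∀ t ∈ Icc a b, f t ∈ U) (hd : HasDerivAt f f' s) : f' ∈ U := by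
  have h1 := hasDerivWithinAt_iff_tendsto_slope.1 (hd.hasDerivWithinAt (s := Icc a b))
  have hne : (nhdsWithin s (Icc a b \ {s})).NeBot := by
    have h2 := (uniqueDiffOn_Icc hab s hs).accPt
    rwa [accPt_principal_iff_nhdsWithin] at h2
  refine (U.closed_of_finiteDimensional).mem_of_tendsto h1 ?_
  filter_upwards [self_mem_nhdsWithin] with t ht
  rw [slope_def_module]
  exact U.smul_mem _ (U.sub_mem (hf t ht.1) (hf s hs))

section Exp

attribute [local instance] Matrix.linftyOpNormedRing Matrix.linftyOpNormedAlgebra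

variable {m : Type*} [Fintype m] [DecidableEq m]

/-- The matrix exponential `e^{tM}`, as a function into the space of families of entries. -/
noncomputable def expFun (M : Matrix m m ℂ) (t : ℝ) : m → m → ℂ :=
  fun i j => NormedSpace.exp (t • M) i j

theorem hasDerivAt_expFun (M : Matrix m m ℂ) (x : ℝ) :
    HasDerivAt (expFun M) (fun i j => (M * NormedSpace.exp (x • M)) i j) x :=
  hasDerivAt_pi.2 fun i => hasDerivAt_pi.2 fun j => by
    let L : Matrix m m ℂ →L[ℝ] ℂ := LinearMap.toContinuousLinearMap (Matrix.entryLinearMap ℝ ℂ i j)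
    exact L.hasFDerivAt.comp_hasDerivAt x (hasDerivAt_exp_smul_const' M x)

theorem continuous_expFun (M : Matrix m m ℂ) : Continuous (expFun M) :=
  continuous_iff_continuousAt.2 fun t => (hasDerivAt_expFun M t).continuousAt

theorem hasMatDeriv_exp (M : Matrix m m ℂ) (x : ℝ) :
    HasMatDeriv (fun t : ℝ => NormedSpace.exp (t • M)) (M * NormedSpace.exp (x • M)) x :=
  fun i j => (hasDerivAt_pi.1 (hasDerivAt_pi.1 (hasDerivAt_expFun M x) i) j).hasDerivWithinAt

open NormedSpace in
-- The time `t` may be negative as long as `x + t ≥ 0`; the window estimate uses `t ∈ [-1, 0]`.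
theorem exp_mul_solution {k : Type*} [Fintype k] {M : Matrix m m ℂ} {Ψ : ℝ → Matrix m k ℂ}
    (hΨ : ∀ x, 0 ≤ x → HasMatDeriv Ψ (M * Ψ x) x) {x t : ℝ} (hx : 0 ≤ x) (hxt : 0 ≤ x + t) :
    exp (t • M) * Ψ x = Ψ (x + t) := by
  have key : ∀ y, 0 ≤ y → Ψ y = exp (y • M) * Ψ 0 := fun y hy => by
    refine sub_eq_zero.1 (eq_zero_of_hasMatDeriv (K := fun _ => M) continuousOn_const
      (y := fun y => Ψ y - exp (y • M) * Ψ 0) (fun z hz => ?_) (by simp) hy)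
    refine ((hΨ z hz).sub ((hasMatDeriv_exp M z).mul_const (Ψ 0))).congr_deriv ?_
    rw [Matrix.mul_sub, Matrix.mul_assoc]
  rw [key x hx, key _ hxt, ← Matrix.mul_assoc]
  congr 1
  have hc : Commute (t • M) (x • M) := ((Commute.refl M).smul_left t).smul_right x
  rw [add_comm, add_smul, Matrix.exp_add_of_commute _ _ hc]

/-- The identity and `M` both lie in the span of the integrals `∫_{-1}^s e^{tM} dt`, so a linear
estimate for those integrals gives one for `1` and `M`. -/
theorem mem_span_integral_exp (M : Matrix m m ℂ) :
    (fun i j => (1 : Matrix m m ℂ) i j : m → m → ℂ) ∈ Submodule.span ℝ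
      ((fun s : ℝ => ∫ t in (-1 : ℝ)..s, expFun M t) '' Icc (-1) 0) ∧
    (fun i j => M i j : m → m → ℂ) ∈ Submodule.span ℝ
      ((fun s : ℝ => ∫ t in (-1 : ℝ)..s, expFun M t) '' Icc (-1) 0) := by
  set U := Submodule.span ℝ ((fun s : ℝ => ∫ t in (-1 : ℝ)..s, expFun M t) '' Icc (-1) 0)
  have hc := continuous_expFun M
  -- Differentiating the integrals in `s` puts `e^{sM}` in the span. At `s = 0` this is the
  -- identity, and a second differentiation there gives `M`.
  have h1 : ∀ s ∈ Icc (-1 : ℝ) 0, expFun M s ∈ U := fun s hs =>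
    mem_of_hasDerivAt (f := fun s : ℝ => ∫ t in (-1 : ℝ)..s, expFun M t) (by norm_num) hs
      (fun t ht => Submodule.subset_span ⟨t, ht, rfl⟩)
      (intervalIntegral.integral_hasDerivAt_right (hc.intervalIntegrable _ _)
        hc.stronglyMeasurable.stronglyMeasurableAtFilter hc.continuousAt)
  have h0 : (0 : ℝ) ∈ Icc (-1 : ℝ) 0 := by simp
  have h2 : NormedSpace.exp ((0 : ℝ) • M) = 1 := by rw [zero_smul, NormedSpace.exp_zero]
  constructor
  · have := h1 0 h0
    unfold expFun at this
    rwa [h2] at this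
  · have := mem_of_hasDerivAt (by norm_num) h0 h1 (hasDerivAt_expFun M 0)
    rwa [h2, Matrix.mul_one] at this

/-- The bound is linear in `u`, so it suffices to prove it for the integrals of `e^{tM}`. For these
the flow property turns the left side into an integral of `f* P Ψ` over part of `[x-1, x]`.
Cauchy–Schwarz bounds its square by the increase of `tr f* S f`, hence by the value at `x` since `S
≥ 0`. The constant is uniform in `f`, which is later chosen depending on `x`. -/
theorem exists_entry_bound {k n : Type*} [Fintype k] [Fintype n] {M : Matrix m m ℂ}
    {Ψ : ℝ → Matrix m k ℂ}
    (hΨ : ∀ x, 0 ≤ x → HasMatDeriv Ψ (M * Ψ x) x) (P : Matrix n m ℂ) {S : ℝ → Matrix n n ℂ}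
    (hS : ∀ x, 0 ≤ x → HasMatDeriv S (P * Ψ x * (P * Ψ x)ᴴ) x)
    (hS0 : ∀ x, 0 ≤ x → (S x).PosSemidef) {u : m → m → ℂ}
    (hu : u ∈ Submodule.span ℝ
      ((fun s : ℝ => ∫ t in (-1 : ℝ)..s, expFun M t) '' Icc (-1) 0)) :
    ∃ C : ℝ, 0 ≤ C ∧ ∀ x, 1 ≤ x → ∀ (q : Type) [Fintype q] (f : Matrix n q ℂ) (l : q) (r : k),
      ‖(fᴴ * (P * (Matrix.of u * Ψ x))) l r‖ ≤ C * √((fᴴ * S x * f).trace.re) := by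
  induction hu using Submodule.span_induction with
  | zero => exact ⟨0, le_rfl, fun x _ q _ f l r => by simp⟩
  | add u v _ _ hu hv =>
    obtain ⟨C, hC0, hC⟩ := hu
    obtain ⟨D, hD0, hD⟩ := hv
    refine ⟨C + D, by positivity, fun x hx q _ f l r => ?_⟩
    rw [← Matrix.of_add_of, Matrix.add_mul, Matrix.mul_add, Matrix.mul_add, Matrix.add_apply,
        add_mul]
    exact (norm_add_le _ _).trans (add_le_add (hC x hx q f l r) (hD x hx q f l r))
  | smul a u _ hu =>
    obtain ⟨C, hC0, hC⟩ := hu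
    refine ⟨|a| * C, by positivity, fun x hx q _ f l r => ?_⟩
    rw [← Matrix.smul_of, Matrix.smul_mul, Matrix.mul_smul, Matrix.mul_smul, Matrix.smul_apply,
      norm_smul, mul_assoc]
    exact mul_le_mul_of_nonneg_left (hC x hx q f l r) (abs_nonneg a)
  | mem u hu =>
    obtain ⟨s, hs, rfl⟩ := hu
    refine ⟨1, zero_le_one, fun x hx q _ f l r => ?_⟩
    rw [one_mul]
    let L : (m → m → ℂ) →L[ℝ] ℂ := LinearMap.toContinuousLinearMap
      { toFun := fun u => (fᴴ * (P * (Matrix.of u * Ψ x))) l r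
        map_add' := fun u v => by
          rw [← Matrix.of_add_of, Matrix.add_mul, Matrix.mul_add, Matrix.mul_add, Matrix.add_apply]
        map_smul' := fun a u => by
          rw [← Matrix.smul_of, Matrix.smul_mul, Matrix.mul_smul, Matrix.mul_smul,
            Matrix.smul_apply]; rfl }
    let g : ℝ → ℂ := fun y => (fᴴ * (P * Ψ y)) l r
    have h1 : (fᴴ * (P * (Matrix.of (∫ t in (-1 : ℝ)..s, expFun M t) * Ψ x))) l r =
        ∫ y in (x - 1)..(x + s), g y := by
      have h2 := L.intervalIntegral_comp_comm ((continuous_expFun M).intervalIntegrable (μ :=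
          volume) (-1) s)
      have h3 : ∫ t in (-1 : ℝ)..s, L (expFun M t) = ∫ t in (-1 : ℝ)..s, g (x + t) := by
        refine intervalIntegral.integral_congr fun t ht => ?_
        rw [uIcc_of_le hs.1] at ht
        change (fᴴ * (P * (NormedSpace.exp (t • M) * Ψ x))) l r = (fᴴ * (P * Ψ (x + t))) l r
        rw [exp_mul_solution hΨ (by linarith) (by linarith [ht.1])]
      rw [h3, intervalIntegral.integral_comp_add_left g x, ← sub_eq_add_neg] at h2
      exact h2.symm
    let h : ℝ → ℝ := fun y => (fᴴ * S y * f).trace.re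
    let τ : ℝ → ℝ := fun y => ((((fᴴ * (P * Ψ y))ᴴ)ᴴ * (fᴴ * (P * Ψ y))ᴴ)).trace.re
    have hh : ∀ y, 0 ≤ y → HasDerivWithinAt h (τ y) (Ici 0) y := fun y hy =>
      (((hS y hy).const_mul fᴴ).mul_const f).re_trace.congr_deriv (by
        simp only [τ, Matrix.conjTranspose_mul, Matrix.conjTranspose_conjTranspose,
          Matrix.mul_assoc])
    have hh0 : ∀ y, 0 ≤ y → 0 ≤ h y := fun y hy =>
      (Complex.le_def.1 ((hS0 y hy).conjTranspose_mul_mul_same f).trace_nonneg).1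
    have hτ : ∀ y, ‖g y‖ ^ 2 ≤ τ y := fun y => by
      have h4 : ∀ B : Matrix q k ℂ, ‖B l r‖ ^ 2 ≤ (Bᴴᴴ * Bᴴ).trace.re := fun B => by
        have h5 : ∀ i, ((Bᴴᴴ * Bᴴ) i i).re = ∑ j, ‖B i j‖ ^ 2 := fun i => by
          rw [Matrix.mul_apply, Complex.re_sum]
          refine Finset.sum_congr rfl fun j _ => ?_
          rw [← Complex.normSq_eq_norm_sq]
          simp [Complex.normSq_apply]
        rw [Matrix.trace, Complex.re_sum]
        calc ‖B l r‖ ^ 2 ≤ ∑ j, ‖B l j‖ ^ 2 := Finset.single_le_sum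
              (f := fun j => ‖B l j‖ ^ 2) (fun j _ => by positivity) (Finset.mem_univ r)
          _ ≤ ∑ i, ∑ j, ‖B i j‖ ^ 2 := Finset.single_le_sum
              (f := fun i => ∑ j, ‖B i j‖ ^ 2) (fun j _ => by positivity) (Finset.mem_univ l)
          _ = _ := by simp only [Matrix.diag_apply, h5]
      exact h4 _
    have hτ0 : ∀ y, 0 ≤ τ y := fun y => (by positivity : 0 ≤ ‖g y‖ ^ 2).trans (hτ y)
    have hmono : ∀ y, 0 ≤ y → y ≤ x → h y ≤ h x := fun y hy hyx =>
      le_of_hasDerivWithinAt_nonneg hh (fun y _ => hτ0 y) hy hyx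
    have hΨc := continuousOn_of_hasMatDeriv hΨ
    have hB : ContinuousOn (fun y => fᴴ * (P * Ψ y)) (Ici 0) :=
      continuousOn_matrix_mul continuousOn_const (continuousOn_matrix_mul continuousOn_const hΨc)
    have hτc : ContinuousOn τ (Ici 0) := by
      have h6 := continuousOn_conjTranspose hB
      exact Complex.continuous_re.comp_continuousOn
        (continuous_id.matrix_trace.comp_continuousOn
          (continuousOn_matrix_mul (continuousOn_conjTranspose h6) h6))
    have hle : x - 1 ≤ x + s := by linarith [hs.1]
    have hsub : Icc (x - 1) (x + s) ⊆ Ici 0 := fun y hy =>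
      (by linarith [hy.1] : (0 : ℝ) ≤ y)
    set v := ‖∫ y in (x - 1)..(x + s), g y‖ with hv
    -- Cauchy–Schwarz in the form `|g| ≤ (|g|²/ε + ε)/2`, integrated over a window of length at most
    -- 1; the choice `ε = v` below yields `v² ≤ h x`.
    have hest : ∀ ε : ℝ, 0 < ε → v ≤ (h x / ε + ε) / 2 := fun ε hε => by
      have h7 : ∫ y in (x - 1)..(x + s), τ y = h (x + s) - h (x - 1) :=
        intervalIntegral.integral_eq_sub_of_hasDeriv_right
          (fun y hy => by
            rw [uIcc_of_le hle] at hy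
            exact ((hh y (hsub hy)).continuousWithinAt).mono
              (by rw [uIcc_of_le hle]; exact hsub))
          (fun y hy => by
            have hy0 : 0 ≤ y := hsub ⟨by simpa [hle] using hy.1.le, by simpa [hle] using hy.2.le⟩
            exact (hh y hy0).mono fun z hz => hy0.trans (le_of_lt hz))
          ((hτc.mono (by rw [uIcc_of_le hle]; exact hsub)).intervalIntegrable)
      have h8 : v ≤ ∫ y in (x - 1)..(x + s), (τ y / ε + ε) / 2 := by
        refine intervalIntegral.norm_integral_le_of_norm_le hle (ae_of_all _ fun y _ => ?_) ?_
        · have h9 : ‖g y‖ ≤ (‖g y‖ ^ 2 / ε + ε) / 2 := by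
            rw [div_add' _ _ _ hε.ne', div_div, le_div_iff₀ (by positivity)]
            nlinarith [sq_nonneg (‖g y‖ - ε)]
          have := hτ y
          exact h9.trans (by gcongr)
        · refine ContinuousOn.intervalIntegrable ?_
          rw [uIcc_of_le hle]
          exact (((hτc.mono hsub).div_const _).add continuousOn_const).div_const _
      have hint : IntervalIntegrable τ volume (x - 1) (x + s) :=
        (hτc.mono (by rw [uIcc_of_le hle]; exact hsub)).intervalIntegrable
      rw [intervalIntegral.integral_div, intervalIntegral.integral_add (hint.div_const _)
        (by simp), intervalIntegral.integral_div, h7, intervalIntegral.integral_const] at h8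
      refine h8.trans ?_
      have h10 := hmono (x + s) (by linarith [hs.1]) (by linarith [hs.2])
      have h11 := hh0 (x - 1) (by linarith)
      have h12 : h (x + s) - h (x - 1) ≤ h x := by linarith
      have h13 : (x + s - (x - 1)) • ε ≤ ε := by
        rw [smul_eq_mul]; nlinarith [hs.2]
      gcongr
    rw [h1]
    refine Real.le_sqrt_of_sq_le ?_
    by_contra hcon
    push Not at hcon
    have hx0 : 0 ≤ h x := hh0 x (by linarith)
    have hcon' : h x < v ^ 2 := hcon
    have hv0 : 0 < v := by
      rcases (norm_nonneg (∫ y in (x - 1)..(x + s), g y)).eq_or_lt with h0 | h0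
      · rw [hv, ← h0] at hcon'; norm_num at hcon'; linarith
      · exact h0
    have h14 := hest v hv0
    rw [div_add' _ _ _ hv0.ne', div_div, le_div_iff₀ (by positivity)] at h14
    nlinarith

end Exp

section Bound

variable {p n : ℕ} {c : ℝ} {α : Matrix (Fin p) (Fin p) ℂ}
  {A S₀ : Matrix (Fin n) (Fin n) ℂ} {Λ₀ : Matrix (Fin n) (Fin p ⊕ Fin p) ℂ}
  {Λ : ℝ → Matrix (Fin n) (Fin p ⊕ Fin p) ℂ} {S : ℝ → Matrix (Fin n) (Fin n) ℂ} {lam : ℂ}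

theorem norm_trace_mul_le {q k : Type*} [Fintype q] [Fintype k] {B : Matrix q k ℂ}
    {a : Matrix k q ℂ} {C : ℝ} (hB : ∀ l r, ‖B l r‖ ≤ C) :
    ‖(B * a).trace‖ ≤ C * ∑ l, ∑ r, ‖a r l‖ := by
  rw [Matrix.trace, Finset.mul_sum]
  refine norm_sum_le_of_le _ fun l _ => ?_
  rw [Matrix.diag_apply, Matrix.mul_apply, Finset.mul_sum]
  refine norm_sum_le_of_le _ fun r _ => ?_
  rw [norm_mul]
  exact mul_le_mul_of_nonneg_right (hB l r) (norm_nonneg _)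

theorem re_trace_gram {q k : Type*} [Fintype q] [Fintype k] (a : Matrix k q ℂ) :
    (aᴴ * a).trace.re = ∑ l, ∑ r, ‖a r l‖ ^ 2 := by
  rw [Matrix.trace, Complex.re_sum]
  refine Finset.sum_congr rfl fun l _ => ?_
  rw [Matrix.diag_apply, Matrix.mul_apply, Complex.re_sum]
  refine Finset.sum_congr rfl fun r _ => ?_
  rw [Matrix.conjTranspose_apply, ← Complex.normSq_eq_norm_sq]
  simp [Complex.normSq_apply]

theorem sq_sum_norm_le (a : Matrix (Fin p) (Fin p) ℂ) :
    (∑ l, ∑ r, ‖a r l‖) ^ 2 ≤ (p : ℝ) ^ 2 * (aᴴ * a).trace.re := by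
  rw [re_trace_gram, ← Finset.sum_product', ← Finset.sum_product']
  have := sq_sum_le_card_mul_sum_sq (s := (Finset.univ : Finset (Fin p)) ×ˢ (Finset.univ))
    (f := fun x => ‖a x.2 x.1‖)
  simpa [pow_two] using this

namespace IsGBDT

/-- The relations `β j β* = 0`, `β β* = 2` and `β' = i c β j` remove all dependence of the
coefficients on `x`. -/
theorem hasMatDeriv_psi_chi (h : IsGBDT (initHam c α) A S₀ Λ₀ Λ S) (hα : α * αᴴ = 1) {x : ℝ}
    (hx : 0 ≤ x) :
    HasMatDeriv (fun t => Λ t * sig p * (beta c α t)ᴴ)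
      (-(Complex.I * c) • (Λ x * (beta c α x)ᴴ)) x ∧
    HasMatDeriv (fun t => Λ t * (beta c α t)ᴴ)
      (-Complex.I • (((2 : ℂ) • A + (c : ℂ) • 1) * (Λ x * sig p * (beta c α x)ᴴ))) x := by
  have hΛ := h.hasMatDeriv_Λ hx
  have hβ := (hasMatDeriv_beta c (α := α) x).conjTranspose
  have h0 := beta_mul_sig_mul_conjTranspose c hα x
  have h2 := beta_mul_conjTranspose c hα x
  have hs : star (Complex.I * (c : ℂ)) = -(Complex.I * c) := by simp
  constructor
  · refine ((hΛ.mul_const (sig p)).mul hβ).congr_deriv ?_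
    simp only [initHam, Matrix.conjTranspose_smul, Matrix.conjTranspose_mul, sig_conjTranspose,
      Matrix.smul_mul, Matrix.mul_smul, Matrix.mul_assoc, h0, hs, sig_mul_sig_mul, Matrix.mul_zero,
      smul_zero, zero_add]
  · refine (hΛ.mul hβ).congr_deriv ?_
    simp only [initHam, Matrix.conjTranspose_smul, Matrix.conjTranspose_mul, sig_conjTranspose,
      Matrix.smul_mul, Matrix.mul_smul, Matrix.mul_assoc, h2, hs, Matrix.mul_one, Matrix.add_mul,
      Matrix.one_mul]
    module

/-- The off-diagonal term `β j Λ* S⁻¹ Λ β*` is bounded on `[1, ∞)` as a quadratic form. -/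
theorem exists_norm_trace_le (h : IsGBDT (initHam c α) A S₀ Λ₀ Λ S) (h₀ : IsTriple A S₀ Λ₀)
    (hα : α * αᴴ = 1) (hc : c ≠ 0) : ∃ C : ℝ, 0 ≤ C ∧ ∀ x, 1 ≤ x →
      ∀ a : Matrix (Fin p) (Fin p) ℂ,
      ‖(aᴴ * ((Λ x * sig p * (beta c α x)ᴴ)ᴴ * ((S x)⁻¹ * (Λ x * (beta c α x)ᴴ * a)))).trace‖ ≤
        C * (aᴴ * a).trace.re := by
  let ψ : ℝ → Matrix (Fin n) (Fin p) ℂ := fun t => Λ t * sig p * (beta c α t)ᴴ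
  let χ : ℝ → Matrix (Fin n) (Fin p) ℂ := fun t => Λ t * (beta c α t)ᴴ
  let M : Matrix (Fin n ⊕ Fin n) (Fin n ⊕ Fin n) ℂ :=
    fromBlocks 0 (-(Complex.I * c) • 1) (-Complex.I • ((2 : ℂ) • A + (c : ℂ) • 1)) 0
  let Ψ : ℝ → Matrix (Fin n ⊕ Fin n) (Fin p) ℂ := fun t => fromRows (ψ t) (χ t)
  have hMΨ : ∀ x, M * Ψ x = fromRows (-(Complex.I * c) • χ x)
      (-Complex.I • (((2 : ℂ) • A + (c : ℂ) • 1) * ψ x)) := fun x => by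
    simp only [M, Ψ, Matrix.fromBlocks_mul_fromRows, Matrix.zero_mul, Matrix.smul_mul,
      Matrix.one_mul, zero_add, add_zero]
  have hΨ : ∀ x, 0 ≤ x → HasMatDeriv Ψ (M * Ψ x) x := fun x hx => by
    rw [hMΨ]
    exact (h.hasMatDeriv_psi_chi hα hx).1.fromRows (h.hasMatDeriv_psi_chi hα hx).2
  let P : Matrix (Fin n) (Fin n ⊕ Fin n) ℂ := fromCols 1 0
  have hP : ∀ a b : Matrix (Fin n) (Fin p) ℂ, P * fromRows a b = a := fun a b => by
    simp [P, Matrix.fromCols_mul_fromRows]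
  have hS : ∀ x, 0 ≤ x → HasMatDeriv S (P * Ψ x * (P * Ψ x)ᴴ) x := fun x hx => by
    simp only [Ψ, hP]
    exact h.hasMatDeriv_S_gram hx
  have hS0 : ∀ x, 0 ≤ x → (S x).PosSemidef := fun x hx => (h.isTriple h₀ hx).posDef.posSemidef
  obtain ⟨C₁, hC₁0, hC₁⟩ := exists_entry_bound hΨ P hS hS0 (mem_span_integral_exp M).1
  obtain ⟨C₂, hC₂0, hC₂⟩ := exists_entry_bound hΨ P hS hS0 (mem_span_integral_exp M).2
  have hc' : 0 < |c| := abs_pos.2 hc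
  refine ⟨C₂ / |c| * C₁ * (p : ℝ) ^ 2, by positivity, fun x hx a => ?_⟩
  have hT := h.isTriple h₀ (zero_le_one.trans hx)
  -- With this test matrix `f* S f = f* ψ a`, so the bound on `f* ψ` gives `F ≤ C₁ √F s`, that is
  -- `√F ≤ C₁ s`; the target is `f* χ a`.
  set f : Matrix (Fin n) (Fin p) ℂ := (S x)⁻¹ * (ψ x * a) with hf
  set s := ∑ l, ∑ r, ‖a r l‖ with hs
  have hs0 : 0 ≤ s := by positivity
  set F := (fᴴ * S x * f).trace.re with hF
  have hψ : ∀ l r, ‖(fᴴ * ψ x) l r‖ ≤ C₁ * √F := fun l r => by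
    have : ‖(fᴴ * (P * ((1 : Matrix (Fin n ⊕ Fin n) (Fin n ⊕ Fin n) ℂ) * Ψ x))) l r‖ ≤ C₁ * √F :=
      hC₁ x hx (Fin p) f l r
    rwa [Matrix.one_mul, hP] at this
  -- The top block of `M Ψ` is `-i c χ`, so the estimate for `M` bounds `χ` after division by `|c|`.
  have hχ : ∀ l r, ‖(fᴴ * χ x) l r‖ ≤ C₂ / |c| * √F := fun l r => by
    have : ‖(fᴴ * (P * (M * Ψ x))) l r‖ ≤ C₂ * √F := hC₂ x hx (Fin p) f l r
    rw [hMΨ, hP, Matrix.mul_smul, Matrix.smul_apply, norm_smul, norm_neg, norm_mul, Complex.norm_I,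
      one_mul, Complex.norm_real, Real.norm_eq_abs] at this
    rw [div_mul_eq_mul_div, le_div_iff₀ hc', mul_comm]
    exact this
  have hfS : fᴴ * S x * f = fᴴ * ψ x * a := by
    have : S x * f = ψ x * a := by
      rw [hf, ← Matrix.mul_assoc, Matrix.mul_nonsing_inv _ hT.isUnit_det, Matrix.one_mul]
    rw [Matrix.mul_assoc fᴴ, this, Matrix.mul_assoc fᴴ]
  have hF0 : 0 ≤ F :=
    (Complex.le_def.1 ((hS0 x (by linarith)).conjTranspose_mul_mul_same f).trace_nonneg).1
  have h1 : √F ≤ C₁ * s := by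
    have h2 : F ≤ C₁ * √F * s := by
      have h3 := norm_trace_mul_le (a := a) hψ
      rw [← hfS] at h3
      exact (Complex.re_le_norm _).trans h3
    rcases (Real.sqrt_nonneg F).eq_or_lt with h4 | h4
    · rw [← h4]; positivity
    · refine le_of_mul_le_mul_left ?_ h4
      rw [Real.mul_self_sqrt hF0]
      linarith
  have h5 : aᴴ * ((Λ x * sig p * (beta c α x)ᴴ)ᴴ * ((S x)⁻¹ * (Λ x * (beta c α x)ᴴ * a))) =
      fᴴ * χ x * a := by
    have : fᴴ = aᴴ * (ψ x)ᴴ * (S x)⁻¹ := by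
      rw [hf, Matrix.conjTranspose_mul ((S x)⁻¹), hT.inv_hermitian, Matrix.conjTranspose_mul (ψ x)]
    rw [this]
    simp only [Matrix.mul_assoc, ψ, χ]
  rw [h5]
  have h6 := norm_trace_mul_le (a := a) hχ
  calc _ ≤ C₂ / |c| * √F * s := h6
    _ ≤ C₂ / |c| * (C₁ * s) * s := by gcongr
    _ = C₂ / |c| * C₁ * s ^ 2 := by ring
    _ ≤ C₂ / |c| * C₁ * ((p : ℝ) ^ 2 * (aᴴ * a).trace.re) := by
      gcongr
      exact sq_sum_norm_le a
    _ = _ := by ring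

end IsGBDT

end Bound

end CanonicalGBDT

/-! ### The growth argument and the limit point case. -/

namespace CanonicalGBDT

/-- The growth argument behind the limit point case. If `J = J₁ + i J₂` satisfies
`|J|² ≤ a B`, with `J₁' = -κ a`, `J₂' = -c B + O(a)` and `J₁ ≤ -δ < 0`, then `J₁` is unbounded. -/
theorem false_of_growth {a B J₁ J₂ r : ℝ → ℝ} {c κ C δ K : ℝ} (hc : c ≠ 0) (hκ : 0 < κ)
    (hC : 0 ≤ C) (hδ : 0 < δ) (ha : ∀ x, 1 ≤ x → 0 ≤ a x) (hB : ∀ x, 1 ≤ x → 0 ≤ B x)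
    (hJ₁ : ∀ x, 1 ≤ x → HasDerivWithinAt J₁ (-κ * a x) (Ici 1) x)
    (hJ₂ : ∀ x, 1 ≤ x → HasDerivWithinAt J₂ (-c * B x + r x) (Ici 1) x)
    (hr : ∀ x, 1 ≤ x → |r x| ≤ C * a x) (hJ : ∀ x, 1 ≤ x → J₁ x ^ 2 + J₂ x ^ 2 ≤ a x * B x)
    (hneg : ∀ x, 1 ≤ x → J₁ x ≤ -δ) (hK : ∀ x, 1 ≤ x → -K ≤ J₁ x) : False := by
  have hc' : 0 < |c| := abs_pos.2 hc
  -- Chosen so that in `G = -c J₂ - m J₁` the term `m κ a` absorbs the error `c r`, leaving `G' ≥ c²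
  -- B`.
  set m := |c| * C / κ with hm
  have hm0 : 0 ≤ m := by positivity
  have hmκ : m * κ = |c| * C := div_mul_cancel₀ _ hκ.ne'
  let G : ℝ → ℝ := fun x => -c * J₂ x - m * J₁ x
  let G' : ℝ → ℝ := fun x => -c * (-c * B x + r x) - m * (-κ * a x)
  have hG : ∀ x, 1 ≤ x → HasDerivWithinAt G (G' x) (Ici 1) x := fun x hx =>
    ((hJ₂ x hx).const_mul (-c)).sub ((hJ₁ x hx).const_mul m)
  have hG' : ∀ x, 1 ≤ x → c ^ 2 * B x ≤ G' x := fun x hx => by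
    have h1 : c * r x ≤ |c| * (C * a x) := by
      refine (le_abs_self _).trans ?_
      rw [abs_mul]
      exact mul_le_mul_of_nonneg_left (hr x hx) hc'.le
    have h2 : G' x = c ^ 2 * B x - c * r x + (m * κ) * a x := by simp only [G']; ring
    rw [h2, hmκ]
    linarith
  have hG'0 : ∀ x, 1 ≤ x → 0 ≤ G' x := fun x hx =>
    (mul_nonneg (sq_nonneg c) (hB x hx)).trans (hG' x hx)
  let E : ℝ → ℝ := fun x => G x - G 1 + 1
  have hE1 : ∀ x, 1 ≤ x → 1 ≤ E x := fun x hx => by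
    have := le_of_hasDerivWithinAt_nonneg hG hG'0 le_rfl hx
    simp only [E]; linarith
  -- The last summand absorbs the additive constant in `E`, using `|J| ≥ δ`; thus `E ≤ k |J|`.
  set k := |c| + m + (|G 1| + 1) / δ with hk
  have hk0 : 0 < k := by positivity
  have hEJ : ∀ x, 1 ≤ x → E x ^ 2 ≤ k ^ 2 * (a x * B x) := fun x hx => by
    set s := √(J₁ x ^ 2 + J₂ x ^ 2) with hs
    have hs0 : 0 ≤ s := Real.sqrt_nonneg _
    have hss : s ^ 2 = J₁ x ^ 2 + J₂ x ^ 2 := Real.sq_sqrt (by positivity)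
    have h1 : |J₁ x| ≤ s := Real.abs_le_sqrt (by nlinarith [sq_nonneg (J₂ x)])
    have h2 : |J₂ x| ≤ s := Real.abs_le_sqrt (by nlinarith [sq_nonneg (J₁ x)])
    have h3 : δ ≤ s := by
      have := neg_abs_le (J₁ x)
      linarith [hneg x hx]
    have h4 : E x ≤ k * s := by
      have h5 : -c * J₂ x ≤ |c| * s := by
        refine (le_abs_self _).trans ?_
        rw [abs_mul, abs_neg]
        exact mul_le_mul_of_nonneg_left h2 hc'.le
      have h6 : -(m * J₁ x) ≤ m * s := by
        rw [← mul_neg]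
        exact mul_le_mul_of_nonneg_left ((neg_le_abs _).trans h1) hm0
      have h7 : -G 1 + 1 ≤ (|G 1| + 1) / δ * s := by
        rw [div_mul_eq_mul_div, le_div_iff₀ hδ]
        have := neg_le_abs (G 1)
        have h8 : 0 ≤ |G 1| + 1 := by positivity
        nlinarith
      have h9 : E x = -c * J₂ x + -(m * J₁ x) + (-G 1 + 1) := by simp only [E, G]; ring
      rw [h9, hk]
      linarith
    have h10 : 0 ≤ E x := by linarith [hE1 x hx]
    calc E x ^ 2 ≤ (k * s) ^ 2 := by gcongr
      _ = k ^ 2 * (J₁ x ^ 2 + J₂ x ^ 2) := by rw [mul_pow, hss]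
      _ ≤ _ := by gcongr; exact hJ x hx
  set μ := k ^ 2 / c ^ 2 with hμ
  have hμ0 : 0 ≤ μ := by positivity
  have hEG : ∀ x, 1 ≤ x → E x ^ 2 ≤ μ * (a x * G' x) := fun x hx => by
    have h1 := hG' x hx
    have h2 : B x ≤ G' x / c ^ 2 := by rw [le_div_iff₀ (by positivity)]; linarith
    calc E x ^ 2 ≤ k ^ 2 * (a x * B x) := hEJ x hx
      _ ≤ k ^ 2 * (a x * (G' x / c ^ 2)) := by
        have := ha x hx
        gcongr
      _ = _ := by rw [hμ]; ring
  -- From `E² ≤ μ a G'` and the arithmetic–geometric mean inequality, `(μ a + G'/E²)/2 ≥ 1`. Both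
  -- summands have bounded primitives, `-(μ/κ) J₁` and `-1/E`, so `x` would be bounded.
  let Φ : ℝ → ℝ := fun x => (μ / κ * -J₁ x - (E x)⁻¹) / 2 - x
  have hΦ : ∀ x, 1 ≤ x → HasDerivWithinAt Φ
      ((μ / κ * -(-κ * a x) - -G' x / E x ^ 2) / 2 - 1) (Ici 1) x := fun x hx => by
    have hE : HasDerivWithinAt E (G' x) (Ici 1) x := ((hG x hx).sub_const _).add_const _
    exact ((((hJ₁ x hx).neg.const_mul (μ / κ)).sub
      (hE.inv (by linarith [hE1 x hx]))).div_const 2).sub (hasDerivWithinAt_id x _)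
  have hΦ' : ∀ x, 1 ≤ x → 0 ≤ (μ / κ * -(-κ * a x) - -G' x / E x ^ 2) / 2 - 1 := fun x hx => by
    have hEpos : 0 < E x := by linarith [hE1 x hx]
    have h1 : μ / κ * -(-κ * a x) = μ * a x := by field_simp
    have h2 : 1 ≤ (μ * a x) * (G' x / E x ^ 2) := by
      rw [← mul_div_assoc, le_div_iff₀ (by positivity), one_mul, mul_assoc]
      exact hEG x hx
    have h3 : 0 ≤ G' x / E x ^ 2 := div_nonneg (hG'0 x hx) (by positivity)
    have h4 : 0 ≤ μ * a x := mul_nonneg hμ0 (ha x hx)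
    rw [h1, neg_div]
    generalize G' x / E x ^ 2 = v at *
    generalize μ * a x = u at *
    nlinarith [sq_nonneg (u - v)]
  have hbound : ∀ x, 1 ≤ x → x ≤ μ / κ * K / 2 - Φ 1 := fun x hx => by
    have h1 := le_of_hasDerivWithinAt_nonneg hΦ hΦ' le_rfl hx
    have h2 : 0 ≤ (E x)⁻¹ := inv_nonneg.2 (by linarith [hE1 x hx])
    have h3 : μ / κ * -J₁ x ≤ μ / κ * K :=
      mul_le_mul_of_nonneg_left (by linarith [hK x hx]) (by positivity)
    have h4 : Φ x = (μ / κ * -J₁ x - (E x)⁻¹) / 2 - x := rfl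
    rw [h4] at h1
    linarith
  have h1 := hbound (max 1 (μ / κ * K / 2 - Φ 1 + 1)) (le_max_left _ _)
  linarith [le_max_right (1 : ℝ) (μ / κ * K / 2 - Φ 1 + 1)]

theorem norm_trace_sq_le {q k : Type*} [Fintype q] [Fintype k] (a b : Matrix k q ℂ) :
    ‖(aᴴ * b).trace‖ ^ 2 ≤ (aᴴ * a).trace.re * (bᴴ * b).trace.re := by
  have h1 : ‖(aᴴ * b).trace‖ ≤ ∑ l, ∑ r, ‖a r l‖ * ‖b r l‖ := by
    rw [Matrix.trace]
    refine norm_sum_le_of_le _ fun l _ => ?_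
    rw [Matrix.diag_apply, Matrix.mul_apply]
    refine norm_sum_le_of_le _ fun r _ => ?_
    rw [norm_mul, Matrix.conjTranspose_apply, norm_star]
  refine (pow_le_pow_left₀ (norm_nonneg _) h1 2).trans ?_
  rw [re_trace_gram, re_trace_gram, ← Finset.sum_product', ← Finset.sum_product',
    ← Finset.sum_product']
  exact Finset.sum_mul_sq_le_sq_mul_sq _ _ _

theorem re_trace_gram_sub_le {q k : Type*} [Fintype q] [Fintype k] (a b : Matrix k q ℂ) :
    ((a - b)ᴴ * (a - b)).trace.re ≤ 2 * (aᴴ * a).trace.re + 2 * (bᴴ * b).trace.re := by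
  simp only [re_trace_gram, Finset.mul_sum, ← Finset.sum_add_distrib]
  refine Finset.sum_le_sum fun l _ => Finset.sum_le_sum fun r _ => ?_
  rw [Matrix.sub_apply]
  have h1 := norm_sub_le (a r l) (b r l)
  have h2 := pow_le_pow_left₀ (norm_nonneg _) h1 2
  nlinarith [sq_nonneg (‖a r l‖ - ‖b r l‖)]

section Uniqueness

variable {p n : ℕ} {c : ℝ} {α : Matrix (Fin p) (Fin p) ℂ}
  {A S₀ : Matrix (Fin n) (Fin n) ℂ} {Λ₀ : Matrix (Fin n) (Fin p ⊕ Fin p) ℂ}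
  {Λ : ℝ → Matrix (Fin n) (Fin p ⊕ Fin p) ℂ} {S : ℝ → Matrix (Fin n) (Fin n) ℂ} {lam : ℂ}

theorem trace_conj_sub {q : Type*} [Fintype q] (t : Matrix q q ℂ) :
    (t - tᴴ).trace.im = 2 * t.trace.im := by
  rw [Matrix.trace_sub, Matrix.trace_conjTranspose]
  simp
  ring

namespace IsGBDT

/-- The derivative of `a* b`, where `a = β u`, `b = β j u` and `u = w_A(·, 0) w` for a solution `w`
of the transformed system. -/
theorem hasMatDeriv_cross (h : IsGBDT (initHam c α) A S₀ Λ₀ Λ S) (h₀ : IsTriple A S₀ Λ₀)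
    (hA : A.det ≠ 0) (hα : α * αᴴ = 1) {w : ℝ → Matrix (Fin p ⊕ Fin p) (Fin p) ℂ} {x : ℝ}
    (hx : 0 ≤ x) (hw : HasMatDeriv w ((Complex.I * lam) • (sig p * transHam c α A Λ S x * w x)) x)
    {a b : ℝ → Matrix (Fin p) (Fin p) ℂ}
    (ha : a = fun t => beta c α t * (transfer A (S t) (Λ t) 0 * w t))
    (hb : b = fun t => beta c α t * (sig p * (transfer A (S t) (Λ t) 0 * w t)))
    {Y : Matrix (Fin p) (Fin p) ℂ}
    (hY : Y = (a x)ᴴ * ((Λ x * sig p * (beta c α x)ᴴ)ᴴ *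
      ((S x)⁻¹ * (Λ x * (beta c α x)ᴴ * a x)))) :
    HasMatDeriv (fun t => (a t)ᴴ * b t)
      (-(Complex.I * c) • ((b x)ᴴ * b x) + (Complex.I * (c + 2 * lam)) • ((a x)ᴴ * a x) +
        (Y - Yᴴ)) x := by
  have hu := h.hasMatDeriv_gauge h₀ hA hx hw
  have hβ := hasMatDeriv_beta c (α := α) x
  have hPh := (h.isTriple h₀ hx).inv_hermitian
  have h0 := beta_mul_sig_mul_conjTranspose c hα x
  have h2 := beta_mul_conjTranspose c hα x
  have hadd := initHam_add c hα x
  have h0' : ∀ Z : Matrix (Fin p) (Fin p) ℂ,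
      beta c α x * (sig p * ((beta c α x)ᴴ * Z)) = 0 := fun Z => by
    have := congrArg (· * Z) h0
    simpa only [Matrix.mul_assoc, Matrix.zero_mul] using this
  have h2' : ∀ Z : Matrix (Fin p) (Fin p) ℂ,
      beta c α x * ((beta c α x)ᴴ * Z) = (2 : ℂ) • Z := fun Z => by
    have := congrArg (· * Z) h2
    simpa only [Matrix.mul_assoc, Matrix.smul_mul, Matrix.one_mul] using this
  have hs : star (Complex.I * (c : ℂ)) = -(Complex.I * c) := by simp
  let X := (Λ x)ᴴ * ((S x)⁻¹ * Λ x)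
  have hax : a x = beta c α x * (transfer A (S x) (Λ x) 0 * w x) := by rw [ha]
  have hbx : b x = beta c α x * (sig p * (transfer A (S x) (Λ x) 0 * w x)) := by rw [hb]
  -- The terms of `u'` beginning with `j H` vanish under `β`, because `β j β* = 0`.
  have hda : HasMatDeriv a ((Complex.I * c) • b x -
      beta c α x * (sig p * (X * (sig p * ((beta c α x)ᴴ * a x))))) x := by
    rw [hax, hbx, ha]
    refine (hβ.mul hu).congr_deriv ?_
    simp only [gauge, initHam, X, Matrix.add_mul, Matrix.sub_mul, Matrix.mul_add, Matrix.mul_sub,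
      Matrix.smul_mul, Matrix.mul_smul, Matrix.mul_assoc, h0', smul_zero, zero_add, zero_sub]
    module
  have hdb : HasMatDeriv b ((Complex.I * (c + 2 * lam)) • a x +
      beta c α x * (sig p * (X * ((beta c α x)ᴴ * a x))) +
      beta c α x * (sig p * (X * (sig p * ((beta c α x)ᴴ * b x)))) -
      beta c α x * (X * (sig p * ((beta c α x)ᴴ * a x)))) x := by
    rw [hax, hbx, hb]
    refine (hβ.mul (hu.const_mul (sig p))).congr_deriv ?_
    -- The term containing `X u` is resolved into `a` and `b` components by `H + j H j = 2`.
    have hsplit : (2 : ℂ) • (beta c α x * (sig p * (X * (transfer A (S x) (Λ x) 0 * w x)))) =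
        beta c α x * (sig p * (X * ((beta c α x)ᴴ * (beta c α x *
          (transfer A (S x) (Λ x) 0 * w x))))) +
        beta c α x * (sig p * (X * (sig p * ((beta c α x)ᴴ * (beta c α x * (sig p *
          (transfer A (S x) (Λ x) 0 * w x))))))) := by
      have := congrArg (fun Z => beta c α x * (sig p * (X * (Z *
        (transfer A (S x) (Λ x) 0 * w x))))) hadd
      simp only [initHam, Matrix.add_mul, Matrix.mul_add, Matrix.smul_mul, Matrix.mul_smul,
        Matrix.mul_assoc, Matrix.one_mul] at this
      exact this.symm
    simp only [gauge, initHam, X, Matrix.add_mul, Matrix.sub_mul, Matrix.mul_add, Matrix.mul_sub,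
      Matrix.smul_mul, Matrix.mul_smul, Matrix.mul_assoc, h2', sig_mul_sig_mul] at hsplit ⊢
    linear_combination (norm := module) hsplit
  -- The mixed terms `a* β j X j β* b` from `a'` and `b'` cancel, so besides `b* b` only terms
  -- quadratic in `a` remain.
  refine (hda.conjTranspose.mul hdb).congr_deriv ?_
  rw [hY]
  simp only [Matrix.conjTranspose_sub, Matrix.conjTranspose_smul, Matrix.conjTranspose_mul, hs,
    sig_conjTranspose, hPh, Matrix.conjTranspose_conjTranspose, Matrix.mul_assoc,
    Matrix.sub_mul, Matrix.mul_sub, Matrix.mul_add, Matrix.smul_mul, Matrix.mul_smul, X]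
  module

end IsGBDT

end Uniqueness

end CanonicalGBDT

namespace CanonicalGBDT

theorem sub_mul_integral_le_of_hasDerivWithinAt {f g : ℝ → ℝ} {κ : ℝ} (hκ : 0 ≤ κ)
    (hf : ContinuousOn f (Ici 0)) (hf0 : ∀ x, 0 ≤ x → 0 ≤ f x) (hfi : IntegrableOn f (Ici 0))
    (hg : ∀ x, 0 ≤ x → HasDerivWithinAt g (-κ * f x) (Ici 0) x) {x : ℝ} (hx : 0 ≤ x) :
    g 0 - κ * ∫ t in Ici 0, f t ≤ g x := by
  have hsub : Set.uIcc 0 x ⊆ Ici 0 := by rw [uIcc_of_le hx]; exact Icc_subset_Ici_self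
  have h1 : ∫ t in (0 : ℝ)..x, -κ * f t = g x - g 0 :=
    intervalIntegral.integral_eq_sub_of_hasDeriv_right
      (fun t ht => ((hg t (hsub ht)).continuousWithinAt).mono hsub)
      (fun t ht => (hg t (by simpa [hx] using ht.1.le)).mono
        (fun y hy => (by simpa [hx] using ht.1.le : (0 : ℝ) ≤ t).trans (le_of_lt hy)))
      ((continuousOn_const.mul (hf.mono hsub)).intervalIntegrable)
  have h2 : ∫ t in (0 : ℝ)..x, f t ≤ ∫ t in Ici 0, f t := by
    rw [intervalIntegral.integral_of_le hx]
    refine setIntegral_mono_set hfi ?_ ?_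
    · exact (ae_restrict_iff' measurableSet_Ici).2 (ae_of_all _ fun t ht => hf0 t ht)
    · exact LE.le.eventuallyLE fun t ht => ht.1.le
  rw [intervalIntegral.integral_const_mul] at h1
  nlinarith [mul_le_mul_of_nonneg_left h2 hκ]

theorem HasMatDeriv.im_trace {m : Type*} [Fintype m] {F : ℝ → Matrix m m ℂ} {F' : Matrix m m ℂ}
    {x : ℝ} (hF : HasMatDeriv F F' x) :
    HasDerivWithinAt (fun t => (F t).trace.im) F'.trace.im (Ici 0) x :=
  Complex.imCLM.hasFDerivAt.comp_hasDerivWithinAt x hF.trace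

theorem re_trace_gram_nonneg {q k : Type*} [Fintype q] [Fintype k] (a : Matrix k q ℂ) :
    0 ≤ (aᴴ * a).trace.re :=
  (Complex.le_def.1 (Matrix.posSemidef_conjTranspose_mul_self a).trace_nonneg).1

theorem im_trace_gram {q k : Type*} [Fintype q] [Fintype k] (a : Matrix k q ℂ) :
    (aᴴ * a).trace.im = 0 :=
  (Complex.le_def.1 (Matrix.posSemidef_conjTranspose_mul_self a).trace_nonneg).2.symm

section LimitPoint

variable {p n : ℕ} {c : ℝ} {α : Matrix (Fin p) (Fin p) ℂ}
  {A S₀ : Matrix (Fin n) (Fin n) ℂ} {Λ₀ : Matrix (Fin n) (Fin p ⊕ Fin p) ℂ}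
  {Λ : ℝ → Matrix (Fin n) (Fin p ⊕ Fin p) ℂ} {S : ℝ → Matrix (Fin n) (Fin n) ℂ} {lam : ℂ}

/-- With `t = u* H j u`, the sum `t + t*` equals `u* (H + j H j) j u = 2 u* j u`. -/
theorem re_trace_cross (hα : α * αᴴ = 1) (x : ℝ) (u : Matrix (Fin p ⊕ Fin p) (Fin p) ℂ) :
    ((beta c α x * u)ᴴ * (beta c α x * (sig p * u))).trace.re = (uᴴ * (sig p * u)).trace.re := by
  set t := (beta c α x * u)ᴴ * (beta c α x * (sig p * u)) with ht
  have h1 : t + tᴴ = (2 : ℂ) • (uᴴ * (sig p * u)) := by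
    have := congrArg (fun Z => uᴴ * (Z * (sig p * u))) (initHam_add c hα x)
    simp only [initHam, Matrix.add_mul, Matrix.mul_add, Matrix.smul_mul, Matrix.mul_smul,
      Matrix.mul_assoc, Matrix.one_mul, sig_mul_sig_mul] at this
    simpa only [ht, Matrix.conjTranspose_mul, Matrix.conjTranspose_conjTranspose, Matrix.mul_assoc,
      sig_conjTranspose] using this
  have h2 := congrArg (fun Z : Matrix (Fin p) (Fin p) ℂ => Z.trace.re) h1
  simp [Matrix.trace_add, Matrix.trace_conjTranspose, Matrix.trace_smul] at h2
  linarith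

theorem IsFundamentalSolution.eq {H W₁ W₂ : ℝ → Matrix (Fin p ⊕ Fin p) (Fin p ⊕ Fin p) ℂ}
    (hH : ContinuousOn H (Ici 0)) (h₁ : IsFundamentalSolution H lam W₁)
    (h₂ : IsFundamentalSolution H lam W₂) {x : ℝ} (hx : 0 ≤ x) : W₁ x = W₂ x := by
  have hK : ContinuousOn (fun t => (Complex.I * lam) • sig p * H t) (Ici 0) :=
    continuousOn_matrix_mul continuousOn_const hH
  refine sub_eq_zero.1 (eq_zero_of_hasMatDeriv (y := fun t => W₁ t - W₂ t) hK (fun t ht =>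
    ((h₁.hasMatDeriv ht).sub (h₂.hasMatDeriv ht)).congr_deriv ?_) ?_ hx)
  · simp only [Matrix.smul_mul, Matrix.mul_sub, Matrix.mul_assoc]
  · rw [h₁.1, h₂.1, sub_self]

namespace IsGBDT

/-- The limit point case: no two distinct matrices give square integrable solutions. -/
theorem eq_of_integrableOn_weylDensity (h : IsGBDT (initHam c α) A S₀ Λ₀ Λ S)
    (h₀ : IsTriple A S₀ Λ₀) (hA : A.det ≠ 0) (hα : α * αᴴ = 1) (hc : c ≠ 0) (hl : lam ∈ upperHalf)
    {W : ℝ → Matrix (Fin p ⊕ Fin p) (Fin p ⊕ Fin p) ℂ}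
    (hW : IsFundamentalSolution (transHam c α A Λ S) lam W) {M₁ M₂ : Matrix (Fin p) (Fin p) ℂ}
    (h₁ : ∀ i k, IntegrableOn (fun x => weylDensity (transHam c α A Λ S x) (W x) M₁ i k) (Ici 0))
    (h₂ : ∀ i k, IntegrableOn (fun x => weylDensity (transHam c α A Λ S x) (W x) M₂ i k) (Ici 0)) :
    M₁ = M₂ := by
  by_contra hne
  have hl' : 0 < lam.im := hl
  let e : Matrix (Fin p) (Fin p) ℂ → Matrix (Fin p ⊕ Fin p) (Fin p) ℂ := fromRows 1
  let w : ℝ → Matrix (Fin p ⊕ Fin p) (Fin p) ℂ := fun t => W t * (e M₁ - e M₂)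
  let u : ℝ → Matrix (Fin p ⊕ Fin p) (Fin p) ℂ := fun t => transfer A (S t) (Λ t) 0 * w t
  let a : ℝ → Matrix (Fin p) (Fin p) ℂ := fun t => beta c α t * u t
  let b : ℝ → Matrix (Fin p) (Fin p) ℂ := fun t => beta c α t * (sig p * u t)
  let Y : ℝ → Matrix (Fin p) (Fin p) ℂ := fun x => (a x)ᴴ *
    ((Λ x * sig p * (beta c α x)ᴴ)ᴴ * ((S x)⁻¹ * (Λ x * (beta c α x)ᴴ * a x)))
  let α₂ : ℝ → ℝ := fun x => ((a x)ᴴ * a x).trace.re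
  let β₂ : ℝ → ℝ := fun x => ((b x)ᴴ * b x).trace.re
  let J₁ : ℝ → ℝ := fun x => ((w x)ᴴ * (sig p * w x)).trace.re
  let J₂ : ℝ → ℝ := fun x => ((a x)ᴴ * b x).trace.im
  obtain ⟨C, hC, hY⟩ := h.exists_norm_trace_le h₀ hα hc
  have hw : ∀ x, 0 ≤ x →
      HasMatDeriv w ((Complex.I * lam) • (sig p * transHam c α A Λ S x * w x)) x :=
    fun x hx => hW.hasMatDeriv_mul (e M₁ - e M₂) hx
  have hgram : ∀ x, (w x)ᴴ * (transHam c α A Λ S x * w x) = (a x)ᴴ * a x := fun x => by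
    simp only [a, u, transHam, betaT, Matrix.conjTranspose_mul, Matrix.mul_assoc]
  have hα0 : ∀ x, 0 ≤ α₂ x := fun x => re_trace_gram_nonneg _
  have hJ₁ : ∀ x, 0 ≤ x → HasDerivWithinAt J₁ (-(2 * lam.im) * α₂ x) (Ici 0) x := fun x hx => by
    refine (hasMatDeriv_form (transHam_conjTranspose x) (hw x hx)).re_trace.congr_deriv ?_
    rw [hgram, Matrix.trace_smul]
    simp [α₂]
  have hJ₂ : ∀ x, 0 ≤ x → HasDerivWithinAt J₂
      (-c * β₂ x + ((c + 2 * lam.re) * α₂ x + 2 * (Y x).trace.im)) (Ici 0) x := fun x hx => by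
    refine (h.hasMatDeriv_cross h₀ hA hα hx (hw x hx) (a := a) (b := b) rfl rfl
      (Y := Y x) rfl).im_trace.congr_deriv ?_
    rw [Matrix.trace_add, Complex.add_im, trace_conj_sub, Matrix.trace_add, Matrix.trace_smul,
      Matrix.trace_smul, Complex.add_im, smul_eq_mul, smul_eq_mul, Complex.mul_im, Complex.mul_im,
      im_trace_gram, im_trace_gram]
    simp [α₂, β₂]
    ring
  have hbound : ∀ x, 1 ≤ x → |(c + 2 * lam.re) * α₂ x + 2 * (Y x).trace.im| ≤
      (|c + 2 * lam.re| + 2 * C) * α₂ x := fun x hx => by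
    have h3 : |(Y x).trace.im| ≤ C * α₂ x := (Complex.abs_im_le_norm _).trans (hY x hx (a x))
    refine (abs_add_le _ _).trans ?_
    rw [abs_mul, abs_mul, abs_of_nonneg (hα0 x), abs_two]
    linarith
  have hJ : ∀ x, 0 ≤ x → J₁ x ^ 2 + J₂ x ^ 2 ≤ α₂ x * β₂ x := fun x hx => by
    have h3 : J₁ x = ((a x)ᴴ * b x).trace.re := by
      rw [re_trace_cross hα x (u x), h.form_transfer_zero_mul h₀ hA (w x) hx]
    have h4 := norm_trace_sq_le (a x) (b x)
    rw [← Complex.normSq_eq_norm_sq, Complex.normSq_apply] at h4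
    rw [h3]
    simp only [J₂]
    linarith
  -- The identity blocks cancel in the difference, so the form starts at a strictly negative value,
  -- and it can only decrease.
  have hw0 : w 0 = fromRows 0 (M₁ - M₂) := by
    simp only [w, hW.1, Matrix.one_mul, e]
    ext (i | i) k <;> simp
  have hJ0 : J₁ 0 = -((M₁ - M₂)ᴴ * (M₁ - M₂)).trace.re := by
    simp only [J₁, hw0, fromRows_sig_fromRows]
    simp
  have hδ : 0 < ((M₁ - M₂)ᴴ * (M₁ - M₂)).trace.re := by
    refine lt_of_le_of_ne (re_trace_gram_nonneg _) fun h3 => hne (sub_eq_zero.1 ?_)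
    exact Matrix.trace_conjTranspose_mul_self_eq_zero_iff.1
      (Complex.ext h3.symm (im_trace_gram _))
  have hneg : ∀ x, 0 ≤ x → J₁ x ≤ -((M₁ - M₂)ᴴ * (M₁ - M₂)).trace.re := fun x hx => by
    have h3 := le_of_hasDerivWithinAt_nonneg (f := fun t => -J₁ t)
      (fun t ht => (hJ₁ t ht).neg) (fun t _ => by nlinarith [hα0 t]) le_rfl hx
    rw [← hJ0]
    linarith
  have hα₂c : ContinuousOn α₂ (Ici 0) := by
    have hwc := continuousOn_of_hasMatDeriv hw
    have h3 : ContinuousOn (fun x => (a x)ᴴ * a x) (Ici 0) :=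
      (continuousOn_matrix_mul (continuousOn_conjTranspose hwc)
        (continuousOn_matrix_mul (h.continuousOn_transHam h₀ hA) hwc)).congr
        fun x _ => (hgram x).symm
    exact Complex.continuous_re.comp_continuousOn
      (continuousOn_finsetSum _ fun i _ => continuousOn_pi.1 (continuousOn_pi.1 h3 i) i)
  have htr : ∀ {M : Matrix (Fin p) (Fin p) ℂ},
      (∀ i k, IntegrableOn (fun x => weylDensity (transHam c α A Λ S x) (W x) M i k) (Ici 0)) →
      IntegrableOn (fun x => (weylDensity (transHam c α A Λ S x) (W x) M).trace.re) (Ici 0) :=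
    fun hM => (integrable_finsetSum _ fun i _ => hM i i).re
  have hα₂i : IntegrableOn α₂ (Ici 0) := by
    refine Integrable.mono' (((htr h₁).const_mul 2).add ((htr h₂).const_mul 2))
      (hα₂c.aestronglyMeasurable measurableSet_Ici) (ae_of_all _ fun x => ?_)
    rw [Real.norm_of_nonneg (hα0 x), Pi.add_apply, weylDensity_transHam, weylDensity_transHam]
    refine le_trans (le_of_eq ?_) (re_trace_gram_sub_le _ _)
    simp only [α₂, a, u, w, betaT, Matrix.mul_sub, Matrix.mul_assoc, e]
  have hsub : Ici (1 : ℝ) ⊆ Ici 0 := Ici_subset_Ici.2 zero_le_one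
  refine false_of_growth hc (by positivity : 0 < 2 * lam.im)
    (by positivity : 0 ≤ |c + 2 * lam.re| + 2 * C) hδ (fun x _ => hα0 x)
    (fun x _ => re_trace_gram_nonneg (b x)) (fun x hx => (hJ₁ x (hsub hx)).mono hsub)
    (fun x hx => (hJ₂ x (hsub hx)).mono hsub) hbound (fun x hx => hJ x (hsub hx))
    (fun x hx => hneg x (hsub hx))
    -- The lower bound on `J₁`: its total decrease is `2 Im lam` times the finite integral of
    -- `|a|²`.
    (K := -(J₁ 0 - 2 * lam.im * ∫ t in Ici 0, α₂ t)) fun x hx => ?_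
  rw [neg_neg]
  exact sub_mul_integral_le_of_hasDerivWithinAt (by positivity) hα₂c (fun x _ => hα0 x) hα₂i hJ₁
    (hsub hx)

end IsGBDT

end LimitPoint

end CanonicalGBDT

theorem theorem5p2 {p n : ℕ} (c : ℝ) (hc : c ≠ 0)
    (α : Matrix (Fin p) (Fin p) ℂ) (hα : α * αᴴ = 1)
    (A S₀ : Matrix (Fin n) (Fin n) ℂ) (Λ₀ : Matrix (Fin n) (Fin p ⊕ Fin p) ℂ)
    (hA : A.det ≠ 0) (hS₀ : S₀.PosDef)
    (hid : A * S₀ - S₀ * Aᴴ = Complex.I • (Λ₀ * CanonicalGBDT.sig p * Λ₀ᴴ))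
    (Λ : ℝ → Matrix (Fin n) (Fin p ⊕ Fin p) ℂ) (S : ℝ → Matrix (Fin n) (Fin n) ℂ)
    (hΛS : CanonicalGBDT.IsGBDT (CanonicalGBDT.initHam c α) A S₀ Λ₀ Λ S) :
    ∃ φ : ℂ → Matrix (Fin p) (Fin p) ℂ,
      CanonicalGBDT.IsWeylFunction (CanonicalGBDT.transHam c α A Λ S) φ ∧
      (∀ ψ : ℂ → Matrix (Fin p) (Fin p) ℂ,
        CanonicalGBDT.IsWeylFunction (CanonicalGBDT.transHam c α A Λ S) ψ →
          Set.EqOn ψ φ CanonicalGBDT.upperHalf) ∧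
      ∀ lam ∈ CanonicalGBDT.upperHalf, (A - lam • 1).det ≠ 0 →
        IsUnit (Matrix.fromCols 1 0 *
          (CanonicalGBDT.darboux A S₀ Λ₀ lam * CanonicalGBDT.E1 c α lam)).det ∧
        φ lam = (Matrix.fromCols 0 1 *
            (CanonicalGBDT.darboux A S₀ Λ₀ lam * CanonicalGBDT.E1 c α lam)) *
          (Matrix.fromCols 1 0 *
            (CanonicalGBDT.darboux A S₀ Λ₀ lam * CanonicalGBDT.E1 c α lam))⁻¹ := by
  have h₀ : CanonicalGBDT.IsTriple A S₀ Λ₀ := ⟨hS₀, hid⟩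
  have hφ := hΛS.isWeylFunction_weylExt h₀ hA hα hc
  refine ⟨_, hφ, fun ψ hψ lam hl => ?_, fun lam hl hlA => ?_⟩
  · obtain ⟨W₁, hW₁, hi₁⟩ := hψ.2 lam hl
    obtain ⟨W₂, hW₂, hi₂⟩ := hφ.2 lam hl
    -- Each Weyl function comes with its own fundamental solution; these agree on `[0, ∞)`, so both
    -- densities can be written with `W₁`.
    refine hΛS.eq_of_integrableOn_weylDensity h₀ hA hα hc hl hW₁ hi₁ fun i k =>
      (hi₂ i k).congr_fun (fun x hx => ?_) measurableSet_Ici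
    simp only [hW₂.eq (hΛS.continuousOn_transHam h₀ hA) hW₁ hx]
  · have h₁ := CanonicalGBDT.fromCols_one_zero_mul
      (CanonicalGBDT.darboux A S₀ Λ₀ lam * CanonicalGBDT.E1 c α lam)
    have h₂ := CanonicalGBDT.fromCols_zero_one_mul
      (CanonicalGBDT.darboux A S₀ Λ₀ lam * CanonicalGBDT.E1 c α lam)
    have hu := hΛS.isUnit_det_top h₀ hA hα hc hl hlA
    have hw := CanonicalGBDT.weylExt_of_det_ne_zero (c := c) (α := α) (S₀ := S₀) (Λ₀ := Λ₀) hlA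
    rw [CanonicalGBDT.weylFormula, ← h₂] at hw
    rw [← h₁] at hu hw
    exact ⟨hu, hw⟩
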